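/- Let $U\subset\mathbb R^3$ be open, let $B_0$ be a $C^\infty$ divergence-free vector field on $U$, let $x^0\in U$ be a point with $B_0(x^0)\neq 0$, and let $0\le s<\frac32$. Then for every $\delta>0$ there is another $C^\infty$ divergence-free vector field $\widetilde B_0\neq B_0$ on $U$ such that 1. $\widetilde B_0$ has a Reeb component in $U$; 2. $\widetilde B_0=B_0$ at all points of $U$ outside the ball of radius $\delta$ centered at $x^0$; 3. $\|B_0-\widetilde B_0\|_{H^s(U)}<\delta$; 4. $\widetilde B_0$ is not topologically equivalent to an MHS equilibrium: there is no $C^\infty$ volume-preserving diffeomorphism $X:U\to U$ such that $B:=X_*\widetilde B_0$ satisfies $B\times\operatorname{curl}B+\nabla P=0$ and $\operatorname{div}B=0$ on $U$ for some $P\in C^\infty(U)$. Here a Reeb component of a vector field $B$ is a smooth compact embedded surface $\mathcal A\subset U$, diffeomorphic to the cylinder $\mathbb S^1\times[0,1]$ and invariant under the flow $X^t$ of $B$, such that $\partial\mathcal A$ consists of two periodic orbits of $B$, both traversed by $B$ in the direction of the boundary orientation of $\partial\mathcal A$ (for one and the same orientation of $\mathcal A$), and $X^t(x)$ converges to $\partial\mathcal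 A$ as $t\to\pm\infty$ for every interior point $x$ of $\mathcal A$. The norm of $H^s(U)$ is the infimum of $\|F\|_{H^s(\mathbb R^3)}=\big(\int(1+|2\pi\xi|^2)^s|\widehat F(\xi)|^2\,d\xi\big)^{1/2}$, with $\widehat F(\xi)=\int e^{-2\pi i x\cdot\xi}F(x)\,dx$, over all extensions $F\in H^s(\mathbb R^3)$ of the given field on $U$. -/

import Mathlib

open MeasureTheory Set Filter Topology
open scoped ENNReal ContDiff FourierTransform

namespace ReebMHS

/-- Euclidean three-space. -/
abbrev R3 : Type := EuclideanSpace ℝ (Fin 3)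

/-! ### Vector calculus

A vector field on an open set `U` is a function `B : R3 → R3`; its values outside `U` are never
used. -/

/-- The partial derivative `∂ⱼ Bᵢ` at the point `x`. -/
noncomputable def pderiv (B : R3 → R3) (j i : Fin 3) (x : R3) : ℝ :=
  (fderiv ℝ B x (EuclideanSpace.single j (1 : ℝ))) i

/-- The divergence of a vector field. -/
noncomputable def div (B : R3 → R3) (x : R3) : ℝ := ∑ i, pderiv B i i x

/-- The curl of a vector field. -/
noncomputable def curl (B : R3 → R3) (x : R3) : R3 :=
  !₂[pderiv B 1 2 x - pderiv B 2 1 x,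
     pderiv B 2 0 x - pderiv B 0 2 x,
     pderiv B 0 1 x - pderiv B 1 0 x]

/-- The vector product of `R3`. -/
noncomputable def cross (v w : R3) : R3 :=
  WithLp.toLp 2 (crossProduct (WithLp.ofLp v) (WithLp.ofLp w))

/-- `B` is a smooth divergence-free vector field on `U`. -/
structure IsSmoothDivFree (U : Set R3) (B : R3 → R3) : Prop where
  smooth : ContDiffOn ℝ ∞ B U
  div_eq_zero : ∀ x ∈ U, div B x = 0

/-- `B` is a smooth magnetohydrostatic equilibrium on `U`: `B × curl B + ∇P = 0` and `div B = 0`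
on `U`, for some smooth function `P` on `U`. -/
structure IsMHSEquilibrium (U : Set R3) (B : R3 → R3) : Prop extends IsSmoothDivFree U B where
  exists_pressure : ∃ P : R3 → ℝ, ContDiffOn ℝ ∞ P U ∧
    ∀ x ∈ U, cross (B x) (curl B x) + gradient P x = 0

/-! ### Topological equivalence -/

/-- A smooth volume-preserving diffeomorphism of the open set `U` onto itself. -/
structure VolumePreservingDiffeo (U : Set R3) where
  toFun : R3 → R3
  invFun : R3 → R3
  mapsTo : MapsTo toFun U U
  mapsTo_inv : MapsTo invFun U U
  left_inv : LeftInvOn invFun toFun U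
  right_inv : RightInvOn invFun toFun U
  smooth : ContDiffOn ℝ ∞ toFun U
  smooth_inv : ContDiffOn ℝ ∞ invFun U
  volume_preserving : ∀ x ∈ U, |(fderiv ℝ toFun x).det| = 1

/-- The push-forward `X_* B` of a vector field on `U`: `(X_* B)(y) = DX(X⁻¹ y) B(X⁻¹ y)`. -/
noncomputable def VolumePreservingDiffeo.pushforward {U : Set R3} (X : VolumePreservingDiffeo U)
    (B : R3 → R3) (y : R3) : R3 :=
  fderiv ℝ X.toFun (X.invFun y) (B (X.invFun y))

/-- `B` is topologically equivalent to some smooth MHS equilibrium on `U`. -/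
def IsTopEquivToMHS (U : Set R3) (B : R3 → R3) : Prop :=
  ∃ X : VolumePreservingDiffeo U, IsMHSEquilibrium U (X.pushforward B)

/-! ### Reeb components -/

/-- `γ` is an integral curve of `B`, defined for all times. -/
def IsIntegralCurve (B : R3 → R3) (γ : ℝ → R3) : Prop :=
  ∀ t, HasDerivAt γ (B (γ t)) t

/-- `C` is a (nontrivial) periodic orbit of `B`. -/
def IsPeriodicOrbit (B : R3 → R3) (C : Set R3) : Prop :=
  ∃ (γ : ℝ → R3) (T : ℝ), 0 < T ∧ IsIntegralCurve B γ ∧ Function.Periodic γ T ∧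
    B (γ 0) ≠ 0 ∧ range γ = C

/-- The strip `ℝ × [0,1]`, the universal cover of the cylinder `(ℝ/ℤ) × [0,1]`. -/
def strip : Set (ℝ × ℝ) := univ ×ˢ Icc (0 : ℝ) 1

/-- `Φ : ℝ × [0,1] → R3` descends to a smooth embedding of the compact cylinder
`(ℝ/ℤ) × [0,1]`: it is smooth up to the boundary, `1`-periodic in the first variable, injective
modulo this period, and an immersion. -/
structure IsCylinderEmbedding (Φ : ℝ × ℝ → R3) : Prop where
  smooth : ContDiffOn ℝ ∞ Φ strip
  periodic : ∀ θ, ∀ r ∈ Icc (0 : ℝ) 1, Φ (θ + 1, r) = Φ (θ, r)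
  injective : ∀ p ∈ strip, ∀ q ∈ strip, Φ p = Φ q → (∃ n : ℤ, q.1 = p.1 + n) ∧ p.2 = q.2
  immersion : ∀ p ∈ strip, Function.Injective (fderivWithin ℝ Φ strip p)

/-- The circle `{r = c}` of the cylinder parametrized by `Φ`. -/
def circleAt (Φ : ℝ × ℝ → R3) (c : ℝ) : Set R3 := range fun θ : ℝ => Φ (θ, c)

/-- The compact cylinder `Φ(ℝ × [0,1])` is a Reeb component, contained in `U`, of the vector
field `B`.

Orient the cylinder by `(∂θ, ∂r)`. With the outward normal first, the boundary orientation is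
given by `∂θ` on `{r = 0}` and by `-∂θ` on `{r = 1}`; fixing this orientation is no restriction
because the other one is obtained from it by replacing `θ` with `-θ`. -/
structure IsReebComponent (U : Set R3) (B : R3 → R3) (Φ : ℝ × ℝ → R3) : Prop where
  embedding : IsCylinderEmbedding Φ
  subset : Φ '' strip ⊆ U
  /-- The cylinder is invariant under the flow of `B`. -/
  invariant : ∀ x ∈ Φ '' strip, ∃ γ : ℝ → R3, γ 0 = x ∧ IsIntegralCurve B γ ∧
    ∀ t, γ t ∈ Φ '' strip
  /-- The two boundary circles are periodic orbits. -/
  periodic_zero : IsPeriodicOrbit B (circleAt Φ 0)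
  periodic_one : IsPeriodicOrbit B (circleAt Φ 1)
  /-- `B` induces the boundary orientation on both boundary circles. -/
  orientation_zero : ∀ θ, ∃ a : ℝ, 0 < a ∧ B (Φ (θ, 0)) = a • deriv (fun τ => Φ (τ, 0)) θ
  orientation_one : ∀ θ, ∃ a : ℝ, 0 < a ∧ B (Φ (θ, 1)) = -(a • deriv (fun τ => Φ (τ, 1)) θ)
  /-- Orbits of interior points converge to the boundary of the cylinder in both time
  directions. -/
  converges : ∀ θ, ∀ r ∈ Ioo (0 : ℝ) 1, ∀ γ : ℝ → R3, γ 0 = Φ (θ, r) → IsIntegralCurve B γ →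
    (∀ t, γ t ∈ Φ '' strip) →
    Tendsto (fun t => Metric.infDist (γ t) (circleAt Φ 0 ∪ circleAt Φ 1)) atTop (𝓝 0) ∧
    Tendsto (fun t => Metric.infDist (γ t) (circleAt Φ 0 ∪ circleAt Φ 1)) atBot (𝓝 0)

/-- `B` has a Reeb component in `U`. -/
def HasReebComponent (U : Set R3) (B : R3 → R3) : Prop :=
  ∃ Φ : ℝ × ℝ → R3, IsReebComponent U B Φ

/-! ### Sobolev norms of real order -/

/-- Complex three-space, where the Fourier transforms of real vector fields take their values. -/
abbrev C3 : Type := EuclideanSpace ℂ (Fin 3)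

/-- The inclusion of `R3` in `C3`. -/
noncomputable def toC3 (v : R3) : C3 := WithLp.toLp 2 fun i => (v i : ℂ)

/-- The norm of `g` in `H^s(ℝ³)`, `s ≥ 0`, namely the square root of
`∫ (1 + |2πξ|²)^s |ĝ(ξ)|² dξ`, with `ĝ(ξ) = ∫ exp(-2πi x·ξ) g(x) dx`.
It is infinite when `g` is not in `H^s`. -/
noncomputable def sobolevNorm (s : ℝ) (g : Lp C3 2 (volume : Measure R3)) : ℝ≥0∞ :=
  (∫⁻ ξ : R3, ENNReal.ofReal ((1 + (2 * Real.pi * ‖ξ‖) ^ 2) ^ s) *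
    ‖(𝓕 g : Lp C3 2 (volume : Measure R3)) ξ‖ₑ ^ 2) ^ (1 / 2 : ℝ)

/-- The norm of `f` in `H^s(U)`, `s ≥ 0`: the infimum of the `H^s(ℝ³)` norms of the extensions
of `f|_U`. It is infinite when `f|_U` is not in `H^s(U)`. -/
noncomputable def sobolevNormOn (s : ℝ) (U : Set R3) (f : R3 → R3) : ℝ≥0∞ :=
  ⨅ (g : Lp C3 2 (volume : Measure R3))
    (_ : ∀ᵐ x ∂((volume : Measure R3).restrict U), g x = toC3 (f x)), sobolevNorm s g

end ReebMHS

namespace ReebMHS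

/-! ### Integrals depending smoothly on a parameter -/

section ParametricIntegral

universe u

variable {E F : Type u} [NormedAddCommGroup E] [NormedSpace ℝ E] [FiniteDimensional ℝ E]
  [NormedAddCommGroup F] [NormedSpace ℝ F]

/-! The obstruction is a sign of circulation. Suppose a field `F` with a Reeb component is an
equilibrium, with current `J = curl F`. Since `F × J = -∇P`, the pressure is constant along orbits.
Interior orbits accumulate on a boundary orbit, so `P` is constant on the cylinder and `F × J` is
normal to it. In the interior `F` is transverse to the circles, which forces the flux density of `J`
through the cylinder to vanish. By Stokes the circulations of `F` along the two boundary circles,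
both traversed in the direction `∂θ`, are equal. But `F` is a positive multiple of `∂θ` on one
circle and a negative multiple on the other: a contradiction. Everything used survives a
diffeomorphism (`not_equilibrium_of_conjugate`, with Stokes in
`circulation_eq_of_curl_flux_eq_zero`).

It remains to insert a Reeb component cheaply. The polynomial field `modelField` has one in the
plane `y 2 = 0`, with explicit orbits. On a ball of radius `3ε` the given field is replaced by the
rescaled model: the difference `B₀ (x₀ + ε • y) - ε • V y`, with `V` the model field, is
divergence-free, hence has a vector potential, and the curl of the cut-off potential is a compactly
supported correction `W ε` (`exists_divFree_interpolation`). It depends smoothly on `ε` up to `ε =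
0`, so it is bounded uniformly in `ε` with its derivatives up to order 4. Concentrating it at scale
`ε` makes its squared `H^s` norm `O(ε^(3 - 2s))`, which tends to zero exactly because `s < 3/2`
(`exists_sobolevNormOn_rescale_le`). -/

theorem hasFDerivAt_intervalIntegral_of_contDiff {f : E → ℝ → F}
    (hf : ContDiff ℝ 1 (Function.uncurry f)) (x₀ : E) (a b : ℝ) :
    HasFDerivAt (fun x => ∫ t in a..b, f x t) (∫ t in a..b, fderiv ℝ (fun x => f x t) x₀) x₀ := by
  have hd : ContDiff ℝ 0 (Function.uncurry fun x t => fderiv ℝ (fun x => f x t) x) := by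
    refine ContDiff.fderiv (f := fun (p : E × ℝ) x => f x p.2) (g := Prod.fst)
      (m := 1) (n := 0) ?_ contDiff_fst (zero_add 1).le
    exact hf.comp (contDiff_snd.prodMk (contDiff_snd.comp contDiff_fst))
  have hd := hd.continuous
  have hc := hf.continuous
  have hpc : ∀ x, Continuous (f x) := fun x => hc.comp (by fun_prop : Continuous fun t => (x, t))
  have hK : IsCompact (Metric.closedBall x₀ 1 ×ˢ uIcc a b) :=
    (isCompact_closedBall _ _).prod isCompact_uIcc
  obtain ⟨C, hC⟩ := hK.exists_bound_of_continuousOn hd.continuousOn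
  refine intervalIntegral.hasFDerivAt_integral_of_dominated_of_fderiv_le
    (F' := fun x t => fderiv ℝ (fun x => f x t) x) (bound := fun _ => C)
    (Metric.ball_mem_nhds x₀ one_pos) (Eventually.of_forall fun x => ?_)
    ((hpc x₀).intervalIntegrable _ _) ?_ ?_ intervalIntegrable_const ?_
  · exact (hpc x).aestronglyMeasurable
  · exact (hd.comp (by fun_prop : Continuous fun t => (x₀, t))).aestronglyMeasurable
  · exact Eventually.of_forall fun t ht x hx =>
      hC (x, t) ⟨Metric.ball_subset_closedBall hx, uIoc_subset_uIcc ht⟩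
  · refine Eventually.of_forall fun t _ x _ => DifferentiableAt.hasFDerivAt ?_
    have : ContDiff ℝ 1 fun x => f x t := hf.comp (contDiff_id.prodMk contDiff_const)
    exact this.differentiable one_ne_zero x

/-- The induction passes from `F` to `E →L[ℝ] F`, so the target must vary; `E` and `F` share a
universe so that this space of maps stays in it. -/
theorem contDiff_nat_intervalIntegral (n : ℕ) {F : Type u} [NormedAddCommGroup F]
    [NormedSpace ℝ F] {f : E → ℝ → F} (hf : ContDiff ℝ ∞ (Function.uncurry f)) (a b : ℝ) :
    ContDiff ℝ n (fun x => ∫ t in a..b, f x t) := by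
  induction n generalizing F with
  | zero =>
    exact contDiff_zero.2 (continuous_iff_continuousAt.2 fun x =>
      (hasFDerivAt_intervalIntegral_of_contDiff (hf.of_le (by simp)) x a b).continuousAt)
  | succ n ih =>
    have h1 := fun x => hasFDerivAt_intervalIntegral_of_contDiff (hf.of_le (by simp)) x a b
    push_cast
    refine contDiff_succ_iff_fderiv.2 ⟨fun x => (h1 x).differentiableAt, by simp, ?_⟩
    rw [show fderiv ℝ (fun x => ∫ t in a..b, f x t) = _ from funext fun x => (h1 x).fderiv]
    refine ih ?_
    refine ContDiff.fderiv (f := fun (p : E × ℝ) x => f x p.2) (g := Prod.fst)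
      (m := ∞) (n := ∞) ?_ contDiff_fst (by simp)
    exact hf.comp (contDiff_snd.prodMk (contDiff_snd.comp contDiff_fst))

theorem contDiff_intervalIntegral {f : E → ℝ → F}
    (hf : ContDiff ℝ ∞ (Function.uncurry f)) (a b : ℝ) :
    ContDiff ℝ ∞ (fun x => ∫ t in a..b, f x t) :=
  contDiff_infty.2 fun n => contDiff_nat_intervalIntegral n hf a b

end ParametricIntegral

/-! ### Curl and divergence as linear functions of the derivative -/

/-- The standard basis vectors. -/
noncomputable abbrev basisVec (j : Fin 3) : R3 := EuclideanSpace.single j (1 : ℝ)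

/-- The curl as a function of the derivative. -/
noncomputable def curlCLM : (R3 →L[ℝ] R3) →L[ℝ] R3 :=
  LinearMap.toContinuousLinearMap
    { toFun := fun L => !₂[L (basisVec 1) 2 - L (basisVec 2) 1,
        L (basisVec 2) 0 - L (basisVec 0) 2, L (basisVec 0) 1 - L (basisVec 1) 0]
      map_add' := fun L M => by
        ext i; fin_cases i <;> simp <;> ring
      map_smul' := fun c L => by
        ext i; fin_cases i <;> simp <;> ring }

theorem curlCLM_apply (L : R3 →L[ℝ] R3) :
    curlCLM L = !₂[L (basisVec 1) 2 - L (basisVec 2) 1,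
        L (basisVec 2) 0 - L (basisVec 0) 2, L (basisVec 0) 1 - L (basisVec 1) 0] := rfl

theorem curl_eq (B : R3 → R3) (x : R3) : curl B x = curlCLM (fderiv ℝ B x) := rfl

theorem div_eq (B : R3 → R3) (x : R3) : div B x = ∑ i, fderiv ℝ B x (basisVec i) i := rfl

/-- The vector product as a continuous bilinear map. -/
noncomputable def crossCLM : R3 →L[ℝ] R3 →L[ℝ] R3 :=
  (LinearMap.mk₂ ℝ cross
    (fun a b c => by ext i; fin_cases i <;> simp [cross])
    (fun a b c => by ext i; fin_cases i <;> simp [cross])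
    (fun a b c => by ext i; fin_cases i <;> simp [cross])
    (fun a b c => by ext i; fin_cases i <;> simp [cross])
      ).toContinuousBilinearMap

theorem crossCLM_apply (v w : R3) : crossCLM v w = cross v w := rfl

theorem eq_sum_basisVec (v : R3) :
    v = v 0 • basisVec 0 + v 1 • basisVec 1 + v 2 • basisVec 2 := by
  ext i; fin_cases i <;> simp

theorem map_eq_sum_basisVec (L : R3 →L[ℝ] R3) (v : R3) :
    L v = v 0 • L (basisVec 0) + v 1 • L (basisVec 1) + v 2 • L (basisVec 2) := by
  conv_lhs => rw [eq_sum_basisVec v]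
  simp only [map_add, map_smul]

/-- This is `curl (a × y) = 2a + (y·∇)a - (div a) y` with `L` the derivative of `a`, the algebra
behind the homotopy formula. -/
theorem curlCLM_cross (L : R3 →L[ℝ] R3) (a y : R3) :
    curlCLM ((crossCLM.flip y).comp L + crossCLM a) =
      (2 : ℝ) • a + L y - (∑ i, L (basisVec i) i) • y := by
  rw [curlCLM_apply, map_eq_sum_basisVec L y]
  ext i
  fin_cases i <;>
  · simp [crossCLM_apply, cross, cross_apply, Fin.sum_univ_three]
    ring

theorem hasFDerivAt_cross_id {a : R3 → R3} {L : R3 →L[ℝ] R3} {y : R3}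
    (ha : HasFDerivAt a L y) :
    HasFDerivAt (fun y => crossCLM (a y) y) ((crossCLM.flip y).comp L + crossCLM (a y)) y := by
  refine ((crossCLM.hasFDerivAt.comp y ha).clm_apply (hasFDerivAt_id y)).congr_fderiv ?_
  ext1 v
  simp [add_comm]

theorem div_curl_eq_zero {A : R3 → R3} (hA : ContDiff ℝ 2 A) (x : R3) : div (curl A) x = 0 := by
  have hd : DifferentiableAt ℝ (fderiv ℝ A) x :=
    (hA.fderiv_right (m := 1) (by norm_num)).differentiable one_ne_zero x
  have hs : IsSymmSndFDerivAt ℝ A x := hA.contDiffAt.isSymmSndFDerivAt (by simp)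
  have h : fderiv ℝ (curl A) x = curlCLM.comp (fderiv ℝ (fderiv ℝ A) x) := by
    rw [show curl A = curlCLM ∘ fderiv ℝ A from rfl]
    exact (curlCLM.hasFDerivAt.comp x hd.hasFDerivAt).fderiv
  rw [div_eq, h]
  simp only [ContinuousLinearMap.comp_apply, curlCLM_apply, Fin.sum_univ_three]
  have h01 := hs (basisVec 0) (basisVec 1)
  have h02 := hs (basisVec 0) (basisVec 2)
  have h12 := hs (basisVec 1) (basisVec 2)
  simp [h01, h02, h12]

/-! ### The vector potential on a ball -/

/-- The homotopy formula for a vector potential. -/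
noncomputable def vectorPotential (D : R3 → R3) (y : R3) : R3 :=
  ∫ t in (0 : ℝ)..1, t • cross (D (t • y)) y

theorem curl_vectorPotential {D : R3 → R3} (hD : ContDiff ℝ ∞ D) {y : R3}
    (h0 : ∀ t ∈ Icc (0 : ℝ) 1, div D (t • y) = 0) : curl (vectorPotential D) y = D y := by
  set f : R3 → ℝ → R3 := fun y t => t • crossCLM (D (t • y)) y with hfdef
  have hf : ContDiff ℝ ∞ (Function.uncurry f) := by
    have h1 : ContDiff ℝ ∞ fun p : R3 × ℝ => D (p.2 • p.1) :=
      hD.comp (contDiff_snd.smul contDiff_fst)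
    exact contDiff_snd.smul ((crossCLM.contDiff.comp h1).clm_apply contDiff_fst)
  have hDd := hD.differentiable (by simp)
  have hfd : ∀ t, HasFDerivAt (fun y => f y t)
      (t • ((crossCLM.flip y).comp (t • fderiv ℝ D (t • y)) + crossCLM (D (t • y)))) y := by
    intro t
    have h1 : HasFDerivAt (fun y : R3 => D (t • y)) (t • fderiv ℝ D (t • y)) y := by
      have := (hDd (t • y)).hasFDerivAt.comp y ((hasFDerivAt_id y).const_smul t)
      refine this.congr_fderiv ?_
      ext v
      simp
    exact (hasFDerivAt_cross_id h1).const_smul t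
  have hG := hasFDerivAt_intervalIntegral_of_contDiff (hf.of_le (by simp)) y 0 1
  have hcont : Continuous fun t : ℝ => fderiv ℝ (fun y => f y t) y := by
    simp_rw [fun t => (hfd t).fderiv]
    have h1 := hD.continuous_fderiv (by simp)
    have h2 := hD.continuous
    fun_prop
  have e1 : curl (vectorPotential D) y = ∫ t in (0 : ℝ)..1, curlCLM (fderiv ℝ (fun y => f y t) y) := by
    rw [curl_eq, curlCLM.intervalIntegral_comp_comm (hcont.intervalIntegrable _ _)]
    exact congrArg curlCLM hG.fderiv
  -- When the divergence vanishes along the segment, the curl of the integrand is the exact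
  -- derivative of `t² D(ty)`, and the integral telescopes to `D y`.
  have e2 : ∀ t ∈ uIcc (0 : ℝ) 1, HasDerivAt (fun t : ℝ => t ^ 2 • D (t • y))
      (curlCLM (fderiv ℝ (fun y => f y t) y)) t := by
    intro t ht
    rw [uIcc_of_le zero_le_one] at ht
    have h1 : HasDerivAt (fun t : ℝ => D (t • y)) (fderiv ℝ D (t • y) y) t := by
      have := (hDd (t • y)).hasFDerivAt.comp_hasDerivAt t ((hasDerivAt_id t).smul_const y)
      exact this.congr_deriv (by simp)
    have h2 := (hasDerivAt_pow 2 t).smul h1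
    refine h2.congr_deriv ?_
    rw [(hfd t).fderiv, map_smul, curlCLM_cross]
    have : ∑ i, (t • fderiv ℝ D (t • y)) (basisVec i) i = 0 := by
      have := h0 t ht
      rw [div_eq] at this
      simp [← Finset.mul_sum, this]
    rw [this]
    simp only [smul_apply]
    module
  rw [e1, intervalIntegral.integral_eq_sub_of_hasDerivAt e2]
  · simp
  · exact ((curlCLM.continuous.comp hcont)).intervalIntegrable _ _

/-! ### Divergence-free interpolation between a field and a rescaled model -/

theorem hasFDerivAt_comp_affine {B : R3 → R3} (a : R3) (c : ℝ) {y : R3}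
    (hB : DifferentiableAt ℝ B (a + c • y)) :
    HasFDerivAt (fun y => B (a + c • y)) (c • fderiv ℝ B (a + c • y)) y := by
  have h := hB.hasFDerivAt.comp y (((hasFDerivAt_id y).const_smul c).const_add a)
  refine h.congr_fderiv ?_
  ext1 v
  simp

theorem div_comp_affine {B : R3 → R3} (a : R3) (c : ℝ) {y : R3}
    (hB : DifferentiableAt ℝ B (a + c • y)) :
    div (fun y => B (a + c • y)) y = c * div B (a + c • y) := by
  rw [div_eq, (hasFDerivAt_comp_affine a c hB).fderiv, div_eq, Finset.mul_sum]
  simp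

theorem div_sub {B C : R3 → R3} {y : R3} (hB : DifferentiableAt ℝ B y)
    (hC : DifferentiableAt ℝ C y) : div (fun y => B y - C y) y = div B y - div C y := by
  simp only [div_eq, fderiv_fun_sub hB hC, ← Finset.sum_sub_distrib]
  simp

theorem div_const_smul {B : R3 → R3} {y : R3} (c : ℝ) (hB : DifferentiableAt ℝ B y) :
    div (fun y => c • B y) y = c * div B y := by
  simp only [div_eq, fderiv_fun_const_smul hB, Finset.mul_sum]
  simp

theorem div_congr {B C : R3 → R3} {y : R3} (h : B =ᶠ[𝓝 y] C) : div B y = div C y := by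
  simp only [div_eq, h.fderiv_eq]

theorem curl_congr {B C : R3 → R3} {y : R3} (h : B =ᶠ[𝓝 y] C) : curl B y = curl C y := by
  simp only [curl_eq, h.fderiv_eq]

theorem contDiff_bump_smul {U : Set R3} (hU : IsOpen U) {B : R3 → R3} (hB : ContDiffOn ℝ ∞ B U)
    {x₀ : R3} (χ : ContDiffBump x₀) (hχ : Metric.closedBall x₀ χ.rOut ⊆ U) :
    ContDiff ℝ ∞ fun x => χ x • B x := by
  refine contDiff_iff_contDiffAt.2 fun x => ?_
  by_cases hx : x ∈ U
  · exact χ.contDiffAt.smul (hB.contDiffAt (hU.mem_nhds hx))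
  · have h1 : x ∉ tsupport χ := fun h => hx (hχ (χ.tsupport_eq ▸ h))
    have h2 : (fun x => χ x • B x) =ᶠ[𝓝 x] fun _ => 0 := by
      filter_upwards [notMem_tsupport_iff_eventuallyEq.1 h1] with z hz
      simp [hz]
    exact contDiffAt_const.congr_of_eventuallyEq h2

/-- Joint smoothness in the parameter, including at zero, is what later yields bounds uniform in
`ε`. -/
theorem contDiff_vectorPotential_family {D : ℝ → R3 → R3} (hD : ContDiff ℝ ∞ (Function.uncurry D)) :
    ContDiff ℝ ∞ fun p : ℝ × R3 => vectorPotential (D p.1) p.2 := by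
  have h1 : ContDiff ℝ ∞ fun q : (ℝ × R3) × ℝ => D q.1.1 (q.2 • q.1.2) :=
    hD.comp (f := fun q : (ℝ × R3) × ℝ => (q.1.1, q.2 • q.1.2)) (by fun_prop)
  have h2 : ContDiff ℝ ∞ fun q : (ℝ × R3) × ℝ => q.2 • crossCLM (D q.1.1 (q.2 • q.1.2)) q.1.2 :=
    contDiff_snd.smul ((crossCLM.contDiff.comp h1).clm_apply (contDiff_snd.comp contDiff_fst))
  exact contDiff_intervalIntegral (E := ℝ × R3) (F := R3)
    (f := fun p t => t • crossCLM (D p.1 (t • p.2)) p.2) h2 0 1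

theorem contDiff_curl_family {H : ℝ → R3 → R3} (hH : ContDiff ℝ ∞ (Function.uncurry H)) :
    ContDiff ℝ ∞ fun p : ℝ × R3 => curl (H p.1) p.2 := by
  have h1 : ContDiff ℝ ∞ fun p : ℝ × R3 => fderiv ℝ (H p.1) p.2 := by
    refine ContDiff.fderiv (f := fun (p : ℝ × R3) x => H p.1 x) (g := Prod.snd)
      (m := ∞) (n := ∞) ?_ contDiff_snd (by simp)
    exact hH.comp ((contDiff_fst.comp contDiff_fst).prodMk contDiff_snd)
  exact curlCLM.contDiff.comp h1

theorem contDiff_of_uncurry {H : ℝ → R3 → R3} (hH : ContDiff ℝ ∞ (Function.uncurry H)) (ε : ℝ) :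
    ContDiff ℝ ∞ (H ε) :=
  hH.comp (contDiff_const.prodMk contDiff_id)

/-- The potential of a family of fields, cut off by `χ`, generates a family of compactly supported
divergence-free fields. -/
theorem exists_divFree_cutoff {D : ℝ → R3 → R3} (hD : ContDiff ℝ ∞ (Function.uncurry D)) :
    ∃ W : ℝ → R3 → R3, ContDiff ℝ ∞ (Function.uncurry W) ∧
      (∀ ε y, 4 ≤ ‖y‖ → W ε y = 0) ∧ (∀ ε y, div (W ε) y = 0) ∧
      ∀ ε, (∀ y ∈ Metric.ball (0 : R3) 3, div (D ε) y = 0) →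
        ∀ y ∈ Metric.ball (0 : R3) 3, W ε y = D ε y := by
  -- The plateau of radius 3 contains the model annulus, which has radius at most 2, with room to
  -- spare; the support radius is below 4, so the field vanishes near every `y` with `4 ≤ ‖y‖`.
  let χ : ContDiffBump (0 : R3) := ⟨3, 7 / 2, by norm_num, by norm_num⟩
  obtain ⟨H, hH⟩ : ∃ H : ℝ → R3 → R3, H = fun ε y => χ y • vectorPotential (D ε) y := ⟨_, rfl⟩
  have hHs : ContDiff ℝ ∞ (Function.uncurry H) := by
    rw [hH]
    exact (χ.contDiff.comp contDiff_snd).smul (contDiff_vectorPotential_family hD)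
  refine ⟨fun ε => curl (H ε), contDiff_curl_family hHs, fun ε y hy => ?_, fun ε y => ?_, ?_⟩
  · have h1 : y ∉ tsupport χ := by
      rw [χ.tsupport_eq]
      simp only [Metric.mem_closedBall, dist_zero_right, not_le]
      show (7 / 2 : ℝ) < _
      linarith
    have h2 : H ε =ᶠ[𝓝 y] fun _ => 0 := by
      filter_upwards [notMem_tsupport_iff_eventuallyEq.1 h1] with z hz
      simp [hH, hz]
    show curl (H ε) y = 0
    rw [curl_congr h2, curl_eq]
    simp
  · exact div_curl_eq_zero (contDiff_infty.1 (contDiff_of_uncurry hHs ε) 2) y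
  · intro ε hdiv y hy
    have h1 : H ε =ᶠ[𝓝 y] vectorPotential (D ε) := by
      filter_upwards [Metric.isOpen_ball.mem_nhds hy] with z hz
      simp only [hH]
      rw [χ.one_of_mem_closedBall (Metric.ball_subset_closedBall hz), one_smul]
    show curl (H ε) y = _
    rw [curl_congr h1, curl_vectorPotential (contDiff_of_uncurry hD ε)]
    intro t ht
    refine hdiv _ ?_
    rw [mem_ball_zero_iff] at hy ⊢
    rw [norm_smul, Real.norm_of_nonneg ht.1]
    have := norm_nonneg y
    nlinarith [ht.2]

/-- There is a smooth family of divergence-free fields supported in a ball, which interpolate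
between the rescalings of `B₀` at `x₀` and the model field `V`. -/
theorem exists_divFree_interpolation {U : Set R3} (hU : IsOpen U) {B₀ : R3 → R3}
    (hB₀ : IsSmoothDivFree U B₀) {x₀ : R3} (hx₀ : x₀ ∈ U) {V : R3 → R3} (hV : ContDiff ℝ ∞ V)
    (hdV : ∀ y, div V y = 0) :
    ∃ W : ℝ → R3 → R3, ContDiff ℝ ∞ (Function.uncurry W) ∧
      (∀ ε y, 4 ≤ ‖y‖ → W ε y = 0) ∧ (∀ ε y, div (W ε) y = 0) ∧
      ∃ ε₀ > 0, ∀ ε, 0 < ε → ε < ε₀ → ∀ y ∈ Metric.ball (0 : R3) 3,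
        W ε y = B₀ (x₀ + ε • y) - ε • V y := by
  obtain ⟨r, hr, hrU⟩ := Metric.nhds_basis_closedBall.mem_iff.1 (hU.mem_nhds hx₀)
  -- Cutting off `B₀` makes the rescaled difference a smooth family for all `ε` and `y`, not only
  -- where `x₀ + ε • y` lies in `U`.
  let χ₀ : ContDiffBump x₀ := ⟨r / 2, r, by positivity, by linarith⟩
  obtain ⟨A, hA⟩ : ∃ A : R3 → R3, A = fun x => χ₀ x • B₀ x := ⟨_, rfl⟩
  have hAs : ContDiff ℝ ∞ A := hA ▸ contDiff_bump_smul hU hB₀.smooth χ₀ hrU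
  have hAB : ∀ x ∈ Metric.ball x₀ (r / 2), A x = B₀ x := by
    intro x hx
    simp only [hA]
    rw [χ₀.one_of_mem_closedBall (Metric.ball_subset_closedBall hx), one_smul]
  obtain ⟨D, hD⟩ : ∃ D : ℝ → R3 → R3, D = fun ε y => A (x₀ + ε • y) - ε • V y := ⟨_, rfl⟩
  have hDs : ContDiff ℝ ∞ (Function.uncurry D) := by
    rw [hD]
    exact (hAs.comp (contDiff_const.add (contDiff_fst.smul contDiff_snd))).sub
      (contDiff_fst.smul (hV.comp contDiff_snd))
  obtain ⟨W, hW, hW0, hdW, hWD⟩ := exists_divFree_cutoff hDs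
  -- For `ε < r / 8` and `‖y‖ < 3` the displacement is below `3r / 8 < r / 2`, where the cut-off is
  -- 1.
  refine ⟨W, hW, hW0, hdW, r / 8, by positivity, fun ε hε hε' y hy => ?_⟩
  have hloc : ∀ z ∈ Metric.ball (0 : R3) 3, x₀ + ε • z ∈ Metric.ball x₀ (r / 2) := by
    intro z hz
    rw [mem_ball_zero_iff] at hz
    rw [mem_ball_iff_norm, add_sub_cancel_left, norm_smul, Real.norm_of_nonneg hε.le]
    have h0 := norm_nonneg z
    nlinarith
  rw [hWD ε _ y hy, hD]
  · simp only
    rw [hAB _ (hloc y hy)]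
  intro z hz
  have hz' := hloc z hz
  have hA1 : div A (x₀ + ε • z) = 0 := by
    rw [div_congr (C := B₀), hB₀.div_eq_zero]
    · exact hrU (Metric.ball_subset_closedBall (Metric.ball_subset_ball (by linarith) hz'))
    · filter_upwards [Metric.isOpen_ball.mem_nhds hz'] with x hx using hAB x hx
  have hAd : Differentiable ℝ A := hAs.differentiable (by simp)
  have hVd : Differentiable ℝ V := hV.differentiable (by simp)
  simp only [hD]
  rw [div_sub (C := fun y => ε • V y) (hasFDerivAt_comp_affine x₀ ε (hAd _)).differentiableAt
    ((hVd z).const_smul ε), div_comp_affine x₀ ε (hAd _), div_const_smul ε (hVd z), hA1, hdV]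
  simp

/-! ### Sobolev norms of rescaled fields -/

/-- The inclusion of `R3` in `C3` as a continuous linear map. -/
noncomputable def toC3CLM : R3 →L[ℝ] C3 :=
  LinearMap.toContinuousLinearMap
    { toFun := toC3
      map_add' := fun v w => by ext i; simp [toC3]
      map_smul' := fun c v => by ext i; simp [toC3] }

theorem toC3CLM_apply (v : R3) : toC3CLM v = toC3 v := rfl

theorem iteratedFDeriv_eq_zero_of_le_norm {F : Type*} [NormedAddCommGroup F] [NormedSpace ℝ F]
    {w : R3 → F} {R : ℝ} (hw : ∀ y, R ≤ ‖y‖ → w y = 0) (n : ℕ) {y : R3} (hy : R < ‖y‖) :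
    iteratedFDeriv ℝ n w y = 0 := by
  have h : w =ᶠ[𝓝 y] fun _ => (0 : F) := by
    filter_upwards [(isOpen_lt continuous_const continuous_norm).mem_nhds hy] with z hz
    exact hw z (le_of_lt hz)
  rw [(h.iteratedFDeriv ℝ n).eq_of_nhds, iteratedFDeriv_fun_zero]
  rfl

/-- Four derivatives in `L¹` buy the factor `‖η‖ ^ 4`; the fixed support turns sup bounds into `L¹`
bounds, so `K` depends only on the volume of the ball. -/
theorem exists_fourier_decay : ∃ K : ℝ, 0 ≤ K ∧ ∀ (w : R3 → C3) (C : ℝ), ContDiff ℝ ∞ w →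
    (∀ y, 4 ≤ ‖y‖ → w y = 0) → (∀ j ≤ 4, ∀ y, ‖iteratedFDeriv ℝ j w y‖ ≤ C) →
    ∀ η, (1 + ‖η‖ ^ 2) ^ 2 * ‖𝓕 w η‖ ≤ K * C := by
  set v : ℝ := (volume : Measure R3).real (Metric.closedBall 0 4) with hv
  -- The estimate below gives `v * C` for `n = 0` and `2 ^ 4 * 5 * (v * C)` for `n = 4`; then `2 + 2
  -- * 80 = 162`.
  refine ⟨162 * v, by positivity, fun w C hw h0 hC η => ?_⟩
  have hcs : HasCompactSupport w := HasCompactSupport.intro (isCompact_closedBall (0 : R3) 4)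
    fun y hy => h0 y (by simpa using (lt_of_not_ge (by simpa using hy)).le)
  have hint : ∀ k n : ℕ, Integrable fun y => ‖y‖ ^ k * ‖iteratedFDeriv ℝ n w y‖ := by
    intro k n
    refine Continuous.integrable_of_hasCompactSupport ?_ ?_
    · have := (hw.of_le (mod_cast le_top : (n : ℕ∞ω) ≤ (∞ : ℕ∞ω))).continuous_iteratedFDeriv'
      fun_prop
    · exact (hcs.iteratedFDeriv n).norm.mul_left
  have hL1 : ∀ j ≤ 4, ∫ y, ‖y‖ ^ 0 * ‖iteratedFDeriv ℝ j w y‖ ≤ v * C := by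
    intro j hj
    have h1 : ∫ y in Metric.closedBall (0 : R3) 4, ‖y‖ ^ 0 * ‖iteratedFDeriv ℝ j w y‖ =
        ∫ y, ‖y‖ ^ 0 * ‖iteratedFDeriv ℝ j w y‖ := by
      refine setIntegral_eq_integral_of_forall_compl_eq_zero fun y hy => ?_
      rw [iteratedFDeriv_eq_zero_of_le_norm h0 j (by simpa using hy)]
      simp
    rw [← h1]
    calc _ ≤ ∫ y in Metric.closedBall (0 : R3) 4, C := by
          refine setIntegral_mono (hint 0 j).integrableOn ?_ fun y => ?_
          · exact integrableOn_const (measure_closedBall_lt_top.ne)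
          · simpa using hC j hj y
      _ = v * C := by simp [hv, smul_eq_mul]
  have key : ∀ n : ℕ, n ≤ 4 → ‖η‖ ^ n * ‖𝓕 w η‖ ≤ 2 ^ n * ((n + 1) * (v * C)) := by
    intro n hn
    have h1 := Real.pow_mul_norm_iteratedFDeriv_fourier_le (K := 0) (N := 4) (n := n) (k := 0)
      (hw.of_le (mod_cast le_top)) (fun k n _ _ => hint k n) (by simp) (by exact_mod_cast hn) η
    rw [norm_iteratedFDeriv_zero] at h1
    refine h1.trans ?_
    have h2 : ∑ p ∈ Finset.range (0 + 1) ×ˢ Finset.range (n + 1),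
        ∫ y, ‖y‖ ^ p.1 * ‖iteratedFDeriv ℝ p.2 w y‖ ≤ (n + 1) * (v * C) := by
      refine (Finset.sum_le_card_nsmul _ _ (v * C) fun p hp => ?_).trans_eq ?_
      · simp only [Finset.mem_product, Finset.mem_range] at hp
        rw [show p.1 = 0 by lia]
        exact hL1 _ (by lia)
      · simp
    rw [pow_zero, one_mul, Nat.cast_zero, mul_zero, zero_add]
    exact mul_le_mul_of_nonneg_left h2 (by positivity)
  have k0 := key 0 (by norm_num)
  have k4 := key 4 le_rfl
  norm_num at k0 k4
  have h3 : (1 + ‖η‖ ^ 2) ^ 2 ≤ 2 + 2 * ‖η‖ ^ 4 := by nlinarith [sq_nonneg (‖η‖ ^ 2 - 1)]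
  calc _ ≤ (2 + 2 * ‖η‖ ^ 4) * ‖𝓕 w η‖ := by gcongr
    _ ≤ _ := by nlinarith

theorem exists_uniform_bound_iteratedFDeriv {W : ℝ → R3 → R3}
    (hW : ContDiff ℝ ∞ (Function.uncurry W)) (h0 : ∀ ε y, 4 ≤ ‖y‖ → W ε y = 0) :
    ∃ C : ℝ, 0 ≤ C ∧ ∀ ε ∈ Icc (0 : ℝ) 1, ∀ j ≤ 4, ∀ y,
      ‖iteratedFDeriv ℝ j (fun y => toC3 (W ε y)) y‖ ≤ C := by
  obtain ⟨G, hG⟩ : ∃ G : ℝ × R3 → C3, G = fun p => toC3CLM (W p.1 p.2) := ⟨_, rfl⟩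
  have hGs : ContDiff ℝ ∞ G := hG ▸ toC3CLM.contDiff.comp hW
  have hb : ∀ j : ℕ, ∃ C : ℝ, ∀ ε ∈ Icc (0 : ℝ) 1, ∀ y,
      ‖iteratedFDeriv ℝ j (fun y => toC3 (W ε y)) y‖ ≤ C := by
    intro j
    have hcont : Continuous (iteratedFDeriv ℝ j G) :=
      (hGs.of_le (mod_cast le_top : (j : ℕ∞ω) ≤ (∞ : ℕ∞ω))).continuous_iteratedFDeriv'
    obtain ⟨C, hC⟩ := (isCompact_Icc.prod (isCompact_closedBall (0 : R3) 4)
      ).exists_bound_of_continuousOn (s := Icc (0 : ℝ) 1 ×ˢ Metric.closedBall (0 : R3) 4)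
      hcont.continuousOn
    refine ⟨max C 0, fun ε hε y => ?_⟩
    rcases le_or_gt ‖y‖ 4 with hy | hy
    -- Derivatives in `y` alone are joint derivatives composed with the inclusion of the second
    -- factor, so compactness of `[0,1]` times a ball bounds them.
    · have h1 : (fun y => toC3 (W ε y)) =
          (fun p => G ((ε, 0) + p)) ∘ (ContinuousLinearMap.inr ℝ ℝ R3) := by
        ext1 y
        simp [hG, toC3CLM_apply]
      have h2 : ContDiff ℝ ∞ fun p => G ((ε, 0) + p) := hGs.comp (contDiff_const.add contDiff_id)
      rw [h1, ContinuousLinearMap.iteratedFDeriv_comp_right _ h2 _ (mod_cast le_top),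
        iteratedFDeriv_comp_add_left]
      refine (ContinuousMultilinearMap.norm_compContinuousLinearMap_le _ _).trans ?_
      have h3 : ‖ContinuousLinearMap.inr ℝ ℝ R3‖ ≤ 1 := ContinuousLinearMap.norm_inr_le_one ℝ ℝ R3
      have h4 : ∏ _i : Fin j, ‖ContinuousLinearMap.inr ℝ ℝ R3‖ ≤ 1 :=
        Finset.prod_le_one (fun _ _ => norm_nonneg _) fun _ _ => h3
      have h5 := hC (ε, y) ⟨hε, by simpa using hy⟩
      have h6 : ((ε, 0) : ℝ × R3) + ContinuousLinearMap.inr ℝ ℝ R3 y = (ε, y) := by simp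
      rw [h6]
      calc _ ≤ ‖iteratedFDeriv ℝ j G (ε, y)‖ * 1 := by gcongr
        _ ≤ _ := by rw [mul_one]; exact h5.trans (le_max_left _ _)
    · rw [iteratedFDeriv_eq_zero_of_le_norm (R := 4) (fun z hz => ?_) j hy]
      · simp
      · rw [h0 ε z hz, ← toC3CLM_apply, map_zero]
  choose C hC using hb
  refine ⟨∑ j ∈ Finset.range 5, max (C j) 0, by positivity, fun ε hε j hj y => ?_⟩
  refine (hC j ε hε y).trans ((le_max_left _ 0).trans ?_)
  exact Finset.single_le_sum (f := fun j => max (C j) 0) (fun _ _ => le_max_right _ _)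
    (Finset.mem_range.2 (by lia))

/-- The dilation produces the Jacobian `ε ^ 3`; the translation only a phase of modulus one. -/
theorem norm_fourier_rescale (w : R3 → C3) (x₀ : R3) {ε : ℝ} (hε : 0 < ε) (ξ : R3) :
    ‖𝓕 (fun x => w (ε⁻¹ • (x - x₀))) ξ‖ = ε ^ 3 * ‖𝓕 w (ε • ξ)‖ := by
  rw [Real.fourier_eq, Real.fourier_eq]
  have h1 : ∫ x, Real.fourierChar (-inner ℝ x ξ) • w (ε⁻¹ • (x - x₀)) =
      ∫ x, Real.fourierChar (-inner ℝ (x + x₀) ξ) • w (ε⁻¹ • x) := by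
    rw [← integral_add_right_eq_self _ x₀]
    simp
  have h2 := Measure.integral_comp_inv_smul_of_nonneg (volume : Measure R3)
    (fun y => Real.fourierChar (-inner ℝ (ε • y + x₀) ξ) • w y) hε.le
  have h3 : ∀ y : R3, Real.fourierChar (-inner ℝ (ε • y + x₀) ξ) • w y =
      (Real.fourierChar (-inner ℝ x₀ ξ) : ℂ) •
        (Real.fourierChar (-inner ℝ y (ε • ξ)) • w y) := by
    intro y
    rw [← Circle.smul_def, smul_smul, ← AddChar.map_add_eq_mul]
    congr 2
    rw [inner_add_left, real_inner_smul_left, real_inner_smul_right]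
    ring
  simp only [smul_inv_smul₀ hε.ne'] at h2
  rw [h1, h2]
  simp_rw [h3]
  rw [integral_smul, norm_smul, norm_smul, Circle.norm_coe]
  simp [abs_of_pos hε]

theorem sobolevNormOn_le (s : ℝ) {U : Set R3} {f : R3 → R3}
    (g : Lp C3 2 (volume : Measure R3))
    (hg : ∀ᵐ x ∂((volume : Measure R3).restrict U), g x = toC3 (f x)) :
    sobolevNormOn s U f ≤ sobolevNorm s g :=
  iInf_le_of_le g (iInf_le_of_le hg le_rfl)

theorem sobolevNormOn_le_of_schwartz (s : ℝ) (U : Set R3) {f : R3 → R3}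
    (g : SchwartzMap R3 C3) (hg : ∀ x, g x = toC3 (f x)) :
    sobolevNormOn s U f ≤ (∫⁻ ξ : R3, ENNReal.ofReal ((1 + (2 * Real.pi * ‖ξ‖) ^ 2) ^ s) *
      ‖𝓕 (g : R3 → C3) ξ‖ₑ ^ 2) ^ (1 / 2 : ℝ) := by
  have h1 : ∀ᵐ x ∂((volume : Measure R3).restrict U), g.toLp 2 volume x = toC3 (f x) := by
    filter_upwards [ae_restrict_of_ae (g.coeFn_toLp 2 volume)] with x hx
    rw [hx, hg]
  refine (sobolevNormOn_le s _ h1).trans ?_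
  unfold sobolevNorm
  rw [SchwartzMap.toLp_fourier_eq]
  refine ENNReal.rpow_le_rpow (lintegral_mono_ae ?_) (by norm_num)
  filter_upwards [(𝓕 g).coeFn_toLp 2 volume] with ξ hξ
  rw [hξ, SchwartzMap.fourier_coe]

/-- With `q = 1 + ‖ε • ξ‖ ^ 2`, the Sobolev weight costs `ε ^ (-2s) * q ^ s`, the squared transform
gives `ε ^ 6 * q ^ (-4)`, and integrating in `ξ` costs `ε ^ (-3)`. Since `s ≤ 2`, the profile is at
most `q ^ (-2)`, integrable in dimension 3. -/
theorem exists_sobolevNormOn_rescale_le {W : ℝ → R3 → R3}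
    (hW : ContDiff ℝ ∞ (Function.uncurry W)) (h0 : ∀ ε y, 4 ≤ ‖y‖ → W ε y = 0) (U : Set R3)
    (x₀ : R3) {s : ℝ} (hs₀ : 0 ≤ s) (hs : s ≤ 2) :
    ∃ A : ℝ, ∀ ε : ℝ, 0 < ε → ε ≤ 1 →
      sobolevNormOn s U (fun x => W ε (ε⁻¹ • (x - x₀))) ≤
        ENNReal.ofReal (A * ε ^ (3 - 2 * s)) ^ (1 / 2 : ℝ) := by
  obtain ⟨K, hK0, hK⟩ := exists_fourier_decay
  obtain ⟨C, hC0, hC⟩ := exists_uniform_bound_iteratedFDeriv hW h0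
  set I : ℝ := ∫ η : R3, (1 + ‖η‖ ^ 2) ^ (-(4 : ℝ) / 2) with hI
  have hIint : Integrable fun η : R3 => (1 + ‖η‖ ^ 2) ^ (-(4 : ℝ) / 2) :=
    integrable_rpow_neg_one_add_norm_sq (by simp; norm_num)
  refine ⟨((2 * Real.pi) ^ 2) ^ s * (K * C) ^ 2 * I, fun ε hε hε1 => ?_⟩
  have hws : ContDiff ℝ ∞ fun y => toC3 (W ε y) :=
    toC3CLM.contDiff.comp (contDiff_of_uncurry hW ε)
  have hw0 : ∀ y, 4 ≤ ‖y‖ → toC3 (W ε y) = 0 := fun y hy => by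
    rw [h0 ε y hy, ← toC3CLM_apply, map_zero]
  have hwF := hK _ C hws hw0 (hC ε ⟨hε.le, hε1⟩)
  obtain ⟨g, hg⟩ : ∃ g : R3 → C3, g = fun x => toC3 (W ε (ε⁻¹ • (x - x₀))) := ⟨_, rfl⟩
  have hgs : ContDiff ℝ ∞ g := by
    rw [hg]
    exact hws.comp (f := fun x => ε⁻¹ • (x - x₀)) (by fun_prop)
  have hgc : HasCompactSupport g := by
    refine HasCompactSupport.intro (isCompact_closedBall x₀ (4 * ε)) fun x hx => ?_
    rw [hg]
    refine hw0 _ ?_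
    rw [norm_smul, norm_inv, Real.norm_of_nonneg hε.le, le_inv_mul_iff₀ hε]
    rw [mem_closedBall_iff_norm, not_le] at hx
    linarith
  have hgF : ∀ ξ, ‖𝓕 g ξ‖ = ε ^ 3 * ‖𝓕 (fun y => toC3 (W ε y)) (ε • ξ)‖ := fun ξ => by
    rw [hg]
    exact norm_fourier_rescale (fun y => toC3 (W ε y)) x₀ hε ξ
  refine (sobolevNormOn_le_of_schwartz s U (hgc.toSchwartzMap hgs) (congrFun hg)).trans ?_
  refine ENNReal.rpow_le_rpow ?_ (by norm_num)
  rw [show (hgc.toSchwartzMap hgs : R3 → C3) = g from rfl]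
  have hpt : ∀ ξ : R3, (1 + (2 * Real.pi * ‖ξ‖) ^ 2) ^ s * ‖𝓕 g ξ‖ ^ 2 ≤
      ((2 * Real.pi) ^ 2) ^ s * (K * C) ^ 2 * ε ^ (6 - 2 * s) *
        (1 + ‖ε • ξ‖ ^ 2) ^ (-(4 : ℝ) / 2) := by
    intro ξ
    set q : ℝ := 1 + ‖ε • ξ‖ ^ 2 with hq
    have hq1 : 1 ≤ q := by rw [hq]; nlinarith [sq_nonneg ‖ε • ξ‖]
    have hq0 : 0 < q := by linarith
    have e1 : 1 + (2 * Real.pi * ‖ξ‖) ^ 2 ≤ (2 * Real.pi) ^ 2 * (ε ^ (-2 : ℝ) * q) := by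
      have h1 : ε ^ (-2 : ℝ) * q = (ε ^ 2)⁻¹ + ‖ξ‖ ^ 2 := by
        rw [hq, norm_smul, Real.norm_of_nonneg hε.le, Real.rpow_neg hε.le]
        norm_cast
        field_simp
      have h2 : 1 ≤ (ε ^ 2)⁻¹ := (one_le_inv₀ (by positivity)).2 (pow_le_one₀ hε.le hε1)
      have h3 : 1 ≤ (2 * Real.pi) ^ 2 := by nlinarith [Real.pi_gt_three]
      rw [h1, mul_pow, mul_add]
      nlinarith
    have e2 : (1 + (2 * Real.pi * ‖ξ‖) ^ 2) ^ s ≤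
        ((2 * Real.pi) ^ 2) ^ s * (ε ^ (-2 * s) * q ^ s) := by
      refine (Real.rpow_le_rpow (by positivity) e1 hs₀).trans_eq ?_
      rw [Real.mul_rpow (by positivity) (by positivity),
        Real.mul_rpow (by positivity) (by positivity), ← Real.rpow_mul hε.le]
    have e3 : ‖𝓕 g ξ‖ ≤ ε ^ 3 * (K * C) * (q ^ 2)⁻¹ := by
      rw [hgF, mul_assoc]
      gcongr
      rw [← div_eq_mul_inv, le_div_iff₀ (by positivity), mul_comm]
      exact hwF (ε • ξ)
    have e4 : q ^ s * ((q ^ 2)⁻¹) ^ 2 ≤ q ^ (-(4 : ℝ) / 2) := by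
      have : ((q ^ 2)⁻¹) ^ 2 = q ^ (-4 : ℝ) := by
        rw [Real.rpow_neg hq0.le]
        norm_cast
        rw [inv_pow, ← pow_mul]
      rw [this, ← Real.rpow_add hq0]
      exact Real.rpow_le_rpow_of_exponent_le hq1 (by linarith)
    calc _ ≤ ((2 * Real.pi) ^ 2) ^ s * (ε ^ (-2 * s) * q ^ s) *
          (ε ^ 3 * (K * C) * (q ^ 2)⁻¹) ^ 2 := by gcongr
      _ = ((2 * Real.pi) ^ 2) ^ s * (K * C) ^ 2 * (ε ^ (-2 * s) * ε ^ 6) *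
          (q ^ s * ((q ^ 2)⁻¹) ^ 2) := by ring
      _ = ((2 * Real.pi) ^ 2) ^ s * (K * C) ^ 2 * ε ^ (6 - 2 * s) *
          (q ^ s * ((q ^ 2)⁻¹) ^ 2) := by
        congr 2
        rw [← Real.rpow_natCast ε 6, ← Real.rpow_add hε]
        congr 1
        push_cast
        ring
      _ ≤ _ := by gcongr
  have hint : Integrable fun ξ : R3 => ((2 * Real.pi) ^ 2) ^ s * (K * C) ^ 2 * ε ^ (6 - 2 * s) *
        (1 + ‖ε • ξ‖ ^ 2) ^ (-(4 : ℝ) / 2) := (hIint.comp_smul hε.ne').const_mul _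
  calc _ ≤ ∫⁻ ξ : R3, ENNReal.ofReal (((2 * Real.pi) ^ 2) ^ s * (K * C) ^ 2 * ε ^ (6 - 2 * s) *
        (1 + ‖ε • ξ‖ ^ 2) ^ (-(4 : ℝ) / 2)) := by
        refine lintegral_mono fun ξ => ?_
        rw [← ofReal_norm, ← ENNReal.ofReal_pow (norm_nonneg _),
          ← ENNReal.ofReal_mul (by positivity)]
        exact ENNReal.ofReal_le_ofReal (hpt ξ)
    _ = _ := by
        rw [← ofReal_integral_eq_lintegral_ofReal hint (Eventually.of_forall fun ξ => by positivity)]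
        congr 1
        rw [integral_const_mul, Measure.integral_comp_smul_of_nonneg (volume : Measure R3)
          (fun η => (1 + ‖η‖ ^ 2) ^ (-(4 : ℝ) / 2)) ε (hR := hε.le), ← hI]
        simp only [finrank_euclideanSpace, Fintype.card_fin, smul_eq_mul]
        have : ε ^ (6 - 2 * s) = ε ^ (3 - 2 * s) * ε ^ 3 := by
          rw [← Real.rpow_natCast ε 3, ← Real.rpow_add hε]
          congr 1
          push_cast
          ring
        rw [this]
        field_simp

theorem exists_sobolevNormOn_rescale_lt {W : ℝ → R3 → R3}
    (hW : ContDiff ℝ ∞ (Function.uncurry W)) (h0 : ∀ ε y, 4 ≤ ‖y‖ → W ε y = 0) (U : Set R3)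
    (x₀ : R3) {s : ℝ} (hs₀ : 0 ≤ s) (hs : s < 3 / 2) {δ : ℝ} (hδ : 0 < δ) :
    ∀ᶠ ε in 𝓝[>] (0 : ℝ),
      sobolevNormOn s U (fun x => W ε (ε⁻¹ • (x - x₀))) < ENNReal.ofReal δ := by
  obtain ⟨A, hA⟩ := exists_sobolevNormOn_rescale_le hW h0 U x₀ hs₀ (by linarith)
  have h1 : Tendsto (fun ε : ℝ => A * ε ^ (3 - 2 * s)) (𝓝 0) (𝓝 0) := by
    have h := ((Real.continuousAt_rpow_const 0 (3 - 2 * s) (Or.inr (by linarith))).tendsto).const_mul A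
    rwa [Real.zero_rpow (by linarith), mul_zero] at h
  have h2 : Tendsto (fun ε : ℝ => ENNReal.ofReal (A * ε ^ (3 - 2 * s)) ^ (1 / 2 : ℝ))
      (𝓝[>] 0) (𝓝 0) := by
    have h := ((ENNReal.continuous_rpow_const (y := (1 / 2 : ℝ))).tendsto _).comp
      (ENNReal.tendsto_ofReal h1)
    rw [ENNReal.ofReal_zero, ENNReal.zero_rpow_of_pos (by norm_num)] at h
    exact h.mono_left nhdsWithin_le_nhds
  filter_upwards [h2.eventually_lt_const (ENNReal.ofReal_pos.2 hδ), self_mem_nhdsWithin,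
    nhdsWithin_le_nhds (Iic_mem_nhds (zero_lt_one' ℝ))] with ε h3 h4 h5
  exact (hA ε h4 h5).trans_lt h3

/-! ### A divergence-free field with a planar Reeb component -/

/-- A polynomial divergence-free field, tangent to the plane `y₂ = 0`, for which the annulus
`1 ≤ y₀² + y₁² ≤ 2` of this plane is a Reeb component. -/
noncomputable def modelField (y : R3) : R3 :=
  !₂[(y 0 ^ 2 + y 1 ^ 2 - 1) * (2 - (y 0 ^ 2 + y 1 ^ 2)) / 2 * y 0
        - (1 - 2 * (y 0 ^ 2 + y 1 ^ 2 - 1) ^ 2) * y 1,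
     (y 0 ^ 2 + y 1 ^ 2 - 1) * (2 - (y 0 ^ 2 + y 1 ^ 2)) / 2 * y 1
        + (1 - 2 * (y 0 ^ 2 + y 1 ^ 2 - 1) ^ 2) * y 0,
     -y 2 * (-3 * (y 0 ^ 2 + y 1 ^ 2) ^ 2 + 6 * (y 0 ^ 2 + y 1 ^ 2) - 2)]

theorem contDiff_coord (i : Fin 3) : ContDiff ℝ ∞ fun y : R3 => y i :=
  (EuclideanSpace.proj (𝕜 := ℝ) i).contDiff

theorem contDiff_modelField : ContDiff ℝ ∞ modelField := by
  have h0 := contDiff_coord 0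
  have h1 := contDiff_coord 1
  have h2 := contDiff_coord 2
  rw [contDiff_euclidean]
  intro i
  fin_cases i <;> simp only [modelField] <;> simp <;> fun_prop

theorem modelField_zero : modelField 0 = 0 := by
  ext i; fin_cases i <;> simp [modelField]

theorem fderiv_apply_coord_eq {B : R3 → R3} {y v : R3} (hB : DifferentiableAt ℝ B y) {i : Fin 3}
    {c : ℝ} (h : HasDerivAt (fun t : ℝ => B (y + t • v) i) c 0) : fderiv ℝ B y v i = c := by
  have h1 : HasDerivAt (fun t : ℝ => B (y + t • v)) (fderiv ℝ B y v) 0 :=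
    hB.hasFDerivAt.hasLineDerivAt v
  have h2 := (EuclideanSpace.proj i : R3 →L[ℝ] ℝ).hasFDerivAt.comp_hasDerivAt
    (0 : ℝ) h1
  exact h2.unique h

/-- The rotational part is divergence-free. The radial part has a divergence depending only on `y 0
^ 2 + y 1 ^ 2`, which the vertical component, linear in `y 2`, cancels without leaving the plane `y
2 = 0`. -/
theorem div_modelField (y : R3) : div modelField y = 0 := by
  have hd := contDiff_modelField.differentiable (by simp) y
  have hlin : ∀ a : ℝ, HasDerivAt (fun t : ℝ => a + t) 1 0 := fun a =>
    (hasDerivAt_id (0 : ℝ)).const_add a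
  have e0 : fderiv ℝ modelField y (basisVec 0) 0 =
      (2 * y 0 * (2 - (y 0 ^ 2 + y 1 ^ 2)) - (y 0 ^ 2 + y 1 ^ 2 - 1) * (2 * y 0)) / 2 * y 0
      + (y 0 ^ 2 + y 1 ^ 2 - 1) * (2 - (y 0 ^ 2 + y 1 ^ 2)) / 2
      + 8 * (y 0 ^ 2 + y 1 ^ 2 - 1) * y 0 * y 1 := by
    refine fderiv_apply_coord_eq hd ?_
    simp only [modelField]
    simp
    have hu := ((hlin (y 0)).pow 2).add_const (y 1 ^ 2)
    have hh := (((hu.sub_const 1).mul (hu.const_sub 2)).div_const 2).mul (hlin (y 0))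
    have hg := ((((hu.sub_const 1).pow 2).const_mul 2).const_sub 1).mul_const (y 1)
    refine (hh.sub hg).congr_deriv ?_
    simp
    ring
  have e1 : fderiv ℝ modelField y (basisVec 1) 1 =
      (2 * y 1 * (2 - (y 0 ^ 2 + y 1 ^ 2)) - (y 0 ^ 2 + y 1 ^ 2 - 1) * (2 * y 1)) / 2 * y 1
      + (y 0 ^ 2 + y 1 ^ 2 - 1) * (2 - (y 0 ^ 2 + y 1 ^ 2)) / 2
      - 8 * (y 0 ^ 2 + y 1 ^ 2 - 1) * y 0 * y 1 := by
    refine fderiv_apply_coord_eq hd ?_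
    simp only [modelField]
    simp
    have hu := ((hlin (y 1)).pow 2).const_add (y 0 ^ 2)
    have hh := (((hu.sub_const 1).mul (hu.const_sub 2)).div_const 2).mul (hlin (y 1))
    have hg := ((((hu.sub_const 1).pow 2).const_mul 2).const_sub 1).mul_const (y 0)
    refine (hh.add hg).congr_deriv ?_
    simp
    ring
  have e2 : fderiv ℝ modelField y (basisVec 2) 2 =
      -(-3 * (y 0 ^ 2 + y 1 ^ 2) ^ 2 + 6 * (y 0 ^ 2 + y 1 ^ 2) - 2) := by
    refine fderiv_apply_coord_eq hd ?_
    simp only [modelField]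
    simp
    refine ((((hlin (y 2)).neg).mul_const
      (-3 * (y 0 ^ 2 + y 1 ^ 2) ^ 2 + 6 * (y 0 ^ 2 + y 1 ^ 2) - 2)).congr_deriv ?_).congr_of_eventuallyEq
        (Eventually.of_forall fun t => ?_)
    · ring
    · simp
  rw [div_eq, Fin.sum_univ_three, e0, e1, e2]
  ring

/-! ### The cylinder -/

/-- The radial unit vector of cylindrical coordinates, as a `1`-periodic function. -/
noncomputable def radialVec (θ : ℝ) : R3 :=
  !₂[Real.cos (2 * Real.pi * θ), Real.sin (2 * Real.pi * θ), 0]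

/-- The angular unit vector of cylindrical coordinates, as a `1`-periodic function. -/
noncomputable def angularVec (θ : ℝ) : R3 :=
  !₂[-Real.sin (2 * Real.pi * θ), Real.cos (2 * Real.pi * θ), 0]

/-- The annulus `1 ≤ y₀² + y₁² ≤ 2` of the plane `y₂ = 0`, parametrized by a cylinder. -/
noncomputable def planarCylinder (p : ℝ × ℝ) : R3 := √(1 + p.2) • radialVec p.1

/-- The tangent vector `∂θ` of `planarCylinder`. -/
noncomputable def cylinderTangentAngle (p : ℝ × ℝ) : R3 :=
  (2 * Real.pi * √(1 + p.2)) • angularVec p.1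

/-- The tangent vector `∂r` of `planarCylinder`. -/
noncomputable def cylinderTangentHeight (p : ℝ × ℝ) : R3 := (1 / (2 * √(1 + p.2))) • radialVec p.1

theorem norm_radialVec (θ : ℝ) : ‖radialVec θ‖ = 1 := by
  rw [EuclideanSpace.norm_eq, Fin.sum_univ_three]
  simp [radialVec]

theorem contDiff_radialVec : ContDiff ℝ ∞ radialVec := by
  rw [contDiff_euclidean]
  intro i
  fin_cases i <;> simp only [radialVec] <;> simp <;> fun_prop

theorem hasDerivAt_radialVec (θ : ℝ) :
    HasDerivAt radialVec ((2 * Real.pi) • angularVec θ) θ := by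
  have h : HasDerivAt (fun θ : ℝ => 2 * Real.pi * θ) (2 * Real.pi) θ := by
    simpa using (hasDerivAt_id θ).const_mul (2 * Real.pi)
  rw [hasDerivAt_iff_hasFDerivAt, ← hasFDerivWithinAt_univ, hasFDerivWithinAt_euclidean]
  intro i
  rw [hasFDerivWithinAt_univ, hasFDerivAt_iff_hasDerivAt]
  fin_cases i
  · refine h.cos.congr_deriv ?_
    simp [angularVec]
    ring
  · refine h.sin.congr_deriv ?_
    simp [angularVec]
    ring
  · refine (hasDerivAt_const θ (0 : ℝ)).congr_deriv ?_
    simp [angularVec]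

theorem radialVec_add_one (θ : ℝ) : radialVec (θ + 1) = radialVec θ := by
  simp [radialVec, mul_add, Real.cos_add_two_pi, Real.sin_add_two_pi]

/-- The parametrization extends smoothly past both boundary circles, so ordinary derivatives are
available on the closed strip. -/
theorem contDiffOn_planarCylinder : ContDiffOn ℝ ∞ planarCylinder {p | -1 < p.2} := by
  refine ContDiffOn.smul (ContDiffOn.sqrt (by fun_prop) fun p hp => ?_)
    (contDiff_radialVec.comp contDiff_fst).contDiffOn
  have : -1 < p.2 := hp
  linarith

theorem hasFDerivAt_planarCylinder {p : ℝ × ℝ} (hp : -1 < p.2) :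
    HasFDerivAt planarCylinder
      ((ContinuousLinearMap.fst ℝ ℝ ℝ).smulRight (cylinderTangentAngle p) +
        (ContinuousLinearMap.snd ℝ ℝ ℝ).smulRight (cylinderTangentHeight p)) p := by
  have h1 : HasFDerivAt (fun p : ℝ × ℝ => √(1 + p.2)) _ p :=
    ((hasFDerivAt_snd (𝕜 := ℝ) (p := p)).const_add 1).sqrt (by linarith)
  have h2 : HasFDerivAt (fun p : ℝ × ℝ => radialVec p.1) _ p :=
    (hasDerivAt_radialVec p.1).hasFDerivAt.comp p (hasFDerivAt_fst (𝕜 := ℝ) (p := p))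
  refine (h1.smul h2).congr_fderiv ?_
  refine ContinuousLinearMap.ext fun v => ?_
  simp [cylinderTangentAngle, cylinderTangentHeight]
  module

theorem hasDerivAt_planarCylinder_comp {α w : ℝ → ℝ} {α' w' t : ℝ} (hα : HasDerivAt α α' t)
    (hw : HasDerivAt w w' t) (h : -1 < w t) :
    HasDerivAt (fun t => planarCylinder (α t, w t))
      (α' • cylinderTangentAngle (α t, w t) + w' • cylinderTangentHeight (α t, w t)) t := by
  have := (hasFDerivAt_planarCylinder (p := (α t, w t)) h).comp_hasDerivAt t (hα.prodMk hw)
  exact this.congr_deriv (by simp)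

/-- In the coordinate `r = y₀² + y₁² - 1` the flow decouples: `r' = r (1 - r²)` and `θ' = (1 - 2r²)
/ (2π)`. The radial speed vanishes at `r = 0, 1`, where the angular speeds are opposite. -/
theorem modelField_planarCylinder {p : ℝ × ℝ} (hp : -1 < p.2) :
    modelField (planarCylinder p) =
      ((1 - 2 * p.2 ^ 2) / (2 * Real.pi)) • cylinderTangentAngle p +
        (p.2 * (1 - p.2 ^ 2)) • cylinderTangentHeight p := by
  have hpos : 0 < √(1 + p.2) := Real.sqrt_pos.2 (by linarith)
  obtain ⟨R, hR⟩ : ∃ R, R = √(1 + p.2) := ⟨_, rfl⟩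
  have hsq : p.2 = R ^ 2 - 1 := by
    rw [hR, Real.sq_sqrt (by linarith)]; ring
  obtain ⟨c, hc⟩ : ∃ c, c = Real.cos (2 * Real.pi * p.1) := ⟨_, rfl⟩
  obtain ⟨σ, hσ⟩ : ∃ σ, σ = Real.sin (2 * Real.pi * p.1) := ⟨_, rfl⟩
  have hcs : (R * c) ^ 2 + (R * σ) ^ 2 = R ^ 2 := by
    rw [hc, hσ]
    linear_combination R ^ 2 * Real.cos_sq_add_sin_sq (2 * Real.pi * p.1)
  have hpi := Real.pi_pos
  rw [← hR] at hpos
  simp only [cylinderTangentAngle, cylinderTangentHeight, planarCylinder, ← hR, radialVec,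
    angularVec, ← hc, ← hσ, smul_smul]
  rw [hsq]
  ext i
  fin_cases i <;> simp [modelField, hcs] <;> field_simp <;> ring

theorem norm_planarCylinder_sub (θ r r' : ℝ) :
    ‖planarCylinder (θ, r) - planarCylinder (θ, r')‖ = |√(1 + r) - √(1 + r')| := by
  simp only [planarCylinder]
  rw [← sub_smul, norm_smul, norm_radialVec, mul_one, Real.norm_eq_abs]

theorem norm_planarCylinder_le {p : ℝ × ℝ} (hp : p.2 ≤ 1) : ‖planarCylinder p‖ ≤ 2 := by
  simp only [planarCylinder]
  rw [norm_smul, norm_radialVec, mul_one, Real.norm_of_nonneg (Real.sqrt_nonneg _)]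
  exact Real.sqrt_le_iff.2 ⟨by norm_num, by linarith⟩

theorem mem_strip {p : ℝ × ℝ} : p ∈ strip ↔ p.2 ∈ Icc (0 : ℝ) 1 := by
  simp [strip]

theorem neg_one_lt_of_mem_strip {p : ℝ × ℝ} (hp : p ∈ strip) : -1 < p.2 := by
  linarith [(mem_strip.1 hp).1]

theorem uniqueDiffOn_strip : UniqueDiffOn ℝ strip :=
  uniqueDiffOn_univ.prod (uniqueDiffOn_Icc zero_lt_one)

theorem fderivWithin_planarCylinder {p : ℝ × ℝ} (hp : p ∈ strip) :
    fderivWithin ℝ planarCylinder strip p =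
      (ContinuousLinearMap.fst ℝ ℝ ℝ).smulRight (cylinderTangentAngle p) +
        (ContinuousLinearMap.snd ℝ ℝ ℝ).smulRight (cylinderTangentHeight p) :=
  (hasFDerivAt_planarCylinder (neg_one_lt_of_mem_strip hp)).hasFDerivWithinAt.fderivWithin
    (uniqueDiffOn_strip p hp)

theorem isCylinderEmbedding_planarCylinder : IsCylinderEmbedding planarCylinder where
  smooth := contDiffOn_planarCylinder.mono fun p hp => neg_one_lt_of_mem_strip hp
  periodic θ r _ := by simp only [planarCylinder, radialVec_add_one]
  injective p hp q hq h := by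
    have hp' := neg_one_lt_of_mem_strip hp
    have hq' := neg_one_lt_of_mem_strip hq
    have h1 : √(1 + p.2) = √(1 + q.2) := by
      have := congrArg norm h
      simpa [planarCylinder, norm_smul, norm_radialVec, abs_of_nonneg, Real.sqrt_nonneg] using this
    have h2 : p.2 = q.2 := by
      rw [Real.sqrt_inj (by linarith) (by linarith)] at h1
      linarith
    refine ⟨?_, h2⟩
    have h3 : radialVec p.1 = radialVec q.1 := by
      simp only [planarCylinder, h1] at h
      exact smul_right_injective R3 (Real.sqrt_pos.2 (by linarith)).ne' h
    have hcos := congrFun (congrArg WithLp.ofLp h3) 0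
    have hsin := congrFun (congrArg WithLp.ofLp h3) 1
    simp only [radialVec] at hcos hsin
    obtain ⟨k, hk⟩ := Real.Angle.angle_eq_iff_two_pi_dvd_sub.1
      (Real.Angle.cos_sin_inj (by simpa using hcos.symm) (by simpa using hsin.symm))
    refine ⟨k, ?_⟩
    have hpi := Real.two_pi_pos
    have : 2 * Real.pi * (q.1 - (p.1 + k)) = 0 := by linear_combination hk
    rcases mul_eq_zero.1 this with h | h
    · exact absurd h hpi.ne'
    · linarith
  immersion p hp := by
    rw [fderivWithin_planarCylinder hp, injective_iff_map_eq_zero]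
    intro v hv
    have hR : 0 < √(1 + p.2) := Real.sqrt_pos.2 (by linarith [neg_one_lt_of_mem_strip hp])
    have hpi := Real.two_pi_pos
    have h0 := congrFun (congrArg WithLp.ofLp hv) 0
    have h1 := congrFun (congrArg WithLp.ofLp hv) 1
    simp [cylinderTangentAngle, cylinderTangentHeight, radialVec, angularVec] at h0 h1
    have hcs := Real.cos_sq_add_sin_sq (2 * Real.pi * p.1)
    -- Pairing with the angular vector, then with the radial one, isolates the two components of
    -- `v`.
    have e1 : v.1 * (2 * Real.pi * √(1 + p.2)) = 0 := by
      linear_combination (-Real.sin (2 * Real.pi * p.1)) * h0 + Real.cos (2 * Real.pi * p.1) * h1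
        - v.1 * (2 * Real.pi * √(1 + p.2)) * hcs
    have e2 : v.2 * ((√(1 + p.2))⁻¹ * 2⁻¹) = 0 := by
      linear_combination (Real.cos (2 * Real.pi * p.1)) * h0 + Real.sin (2 * Real.pi * p.1) * h1
        - v.2 * ((√(1 + p.2))⁻¹ * 2⁻¹) * hcs
    ext
    · exact (mul_eq_zero.1 e1).resolve_right (by positivity)
    · exact (mul_eq_zero.1 e2).resolve_right (by positivity)

/-! ### Orbits on the cylinder -/

/-- An auxiliary function for the explicit solution of `r' = r (1 - r²)`, `r(0) = c`. -/
noncomputable def orbitDenom (c t : ℝ) : ℝ := c ^ 2 + (1 - c ^ 2) * Real.exp (-2 * t)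

/-- The solution of `r' = r (1 - r²)`, `r(0) = c`. -/
noncomputable def orbitHeight (c t : ℝ) : ℝ := c / √(orbitDenom c t)

/-- The angle along the orbit of the model field through the point `(θ, c)` of the cylinder. -/
noncomputable def orbitAngle (θ c t : ℝ) : ℝ :=
  θ + (-t - Real.log (orbitDenom c t)) / (2 * Real.pi)

/-- The orbit of the model field through the point `(θ, c)` of the cylinder. -/
noncomputable def planarOrbit (θ c t : ℝ) : R3 := planarCylinder (orbitAngle θ c t, orbitHeight c t)

theorem sq_le_orbitDenom {c : ℝ} (hc : c ∈ Icc (0 : ℝ) 1) (t : ℝ) : c ^ 2 ≤ orbitDenom c t := by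
  have h : 0 ≤ 1 - c ^ 2 := by nlinarith [hc.1, hc.2]
  have := mul_nonneg h (Real.exp_pos (-2 * t)).le
  unfold orbitDenom
  linarith

theorem orbitDenom_pos {c : ℝ} (hc : c ∈ Icc (0 : ℝ) 1) (t : ℝ) : 0 < orbitDenom c t := by
  rcases hc.1.eq_or_lt with h | h
  · simp [orbitDenom, ← h, Real.exp_pos]
  · exact (by positivity : 0 < c ^ 2).trans_le (sq_le_orbitDenom hc t)

theorem orbitHeight_mem {c : ℝ} (hc : c ∈ Icc (0 : ℝ) 1) (t : ℝ) :
    orbitHeight c t ∈ Icc (0 : ℝ) 1 := by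
  have h := orbitDenom_pos hc t
  refine ⟨div_nonneg hc.1 (Real.sqrt_nonneg _), ?_⟩
  rw [orbitHeight, div_le_one (Real.sqrt_pos.2 h)]
  exact Real.le_sqrt_of_sq_le (sq_le_orbitDenom hc t)

theorem hasDerivAt_orbitDenom (c t : ℝ) :
    HasDerivAt (orbitDenom c) (2 * (c ^ 2 - orbitDenom c t)) t := by
  have h1 : HasDerivAt (fun t : ℝ => -2 * t) (-2) t := by
    simpa using (hasDerivAt_id t).const_mul (-2 : ℝ)
  refine ((h1.exp.const_mul (1 - c ^ 2)).const_add (c ^ 2)).congr_deriv ?_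
  simp only [orbitDenom]
  ring

theorem orbitHeight_sq {c : ℝ} (hc : c ∈ Icc (0 : ℝ) 1) (t : ℝ) :
    orbitHeight c t ^ 2 = c ^ 2 / orbitDenom c t := by
  rw [orbitHeight, div_pow, Real.sq_sqrt (orbitDenom_pos hc t).le]

/-- For `c ≠ 0` the substitution `k = c² / r²` makes the equation linear, `k' = 2 (c² - k)`; working
with `k` also covers `c = 0`. -/
theorem hasDerivAt_orbitHeight {c : ℝ} (hc : c ∈ Icc (0 : ℝ) 1) (t : ℝ) :
    HasDerivAt (orbitHeight c) (orbitHeight c t * (1 - orbitHeight c t ^ 2)) t := by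
  have hk := orbitDenom_pos hc t
  have hs : 0 < √(orbitDenom c t) := Real.sqrt_pos.2 hk
  refine ((hasDerivAt_const t c).div ((hasDerivAt_orbitDenom c t).sqrt hk.ne') hs.ne').congr_deriv ?_
  rw [orbitHeight_sq hc, orbitHeight]
  have h2 : √(orbitDenom c t) ^ 2 = orbitDenom c t := Real.sq_sqrt hk.le
  rw [h2]
  field_simp
  ring

/-- Because `(log k)' = 2 (r² - 1)` for `k = orbitDenom c`, the function `-t - log k` has derivative
`1 - 2r²`. -/
theorem hasDerivAt_orbitAngle {c : ℝ} (hc : c ∈ Icc (0 : ℝ) 1) (θ t : ℝ) :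
    HasDerivAt (orbitAngle θ c) ((1 - 2 * orbitHeight c t ^ 2) / (2 * Real.pi)) t := by
  have hk := orbitDenom_pos hc t
  refine ((((hasDerivAt_id t).neg.sub ((hasDerivAt_orbitDenom c t).log hk.ne')).div_const
    (2 * Real.pi)).const_add θ).congr_deriv ?_
  rw [orbitHeight_sq hc]
  field_simp
  ring

theorem hasDerivAt_planarOrbit {c : ℝ} (hc : c ∈ Icc (0 : ℝ) 1) (θ t : ℝ) :
    HasDerivAt (planarOrbit θ c) (modelField (planarOrbit θ c t)) t := by
  have h : -1 < orbitHeight c t := by linarith [(orbitHeight_mem hc t).1]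
  refine (hasDerivAt_planarCylinder_comp (hasDerivAt_orbitAngle hc θ t)
    (hasDerivAt_orbitHeight hc t) h).congr_deriv ?_
  rw [planarOrbit, modelField_planarCylinder h]

theorem planarOrbit_apply_zero (θ c : ℝ) : planarOrbit θ c 0 = planarCylinder (θ, c) := by
  simp [planarOrbit, orbitAngle, orbitHeight, orbitDenom]

theorem planarOrbit_height_zero (θ t : ℝ) :
    planarOrbit θ 0 t = planarCylinder (θ + t / (2 * Real.pi), 0) := by
  simp only [planarOrbit, orbitAngle, orbitHeight, orbitDenom]
  simp
  congr 2
  ring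

theorem planarOrbit_height_one (θ t : ℝ) :
    planarOrbit θ 1 t = planarCylinder (θ - t / (2 * Real.pi), 1) := by
  simp only [planarOrbit, orbitAngle, orbitHeight, orbitDenom]
  simp
  congr 2
  ring

theorem tendsto_orbitHeight_atTop {c : ℝ} (hc : c ∈ Ioo (0 : ℝ) 1) :
    Tendsto (orbitHeight c) atTop (𝓝 1) := by
  have h1 : Tendsto (fun t : ℝ => Real.exp (-2 * t)) atTop (𝓝 0) :=
    Real.tendsto_exp_atBot.comp (tendsto_id.const_mul_atTop_of_neg (by norm_num))
  have h2 : Tendsto (orbitDenom c) atTop (𝓝 (c ^ 2)) := by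
    have h := (h1.const_mul (1 - c ^ 2)).const_add (c ^ 2)
    rwa [mul_zero, add_zero] at h
  have h3 := (tendsto_const_nhds (x := c)).div h2.sqrt
    (by rw [Real.sqrt_sq hc.1.le]; exact hc.1.ne')
  rwa [Real.sqrt_sq hc.1.le, div_self hc.1.ne'] at h3

theorem tendsto_orbitHeight_atBot {c : ℝ} (hc : c ∈ Ico (0 : ℝ) 1) :
    Tendsto (orbitHeight c) atBot (𝓝 0) := by
  have hc2 : 0 < 1 - c ^ 2 := by nlinarith [hc.1, hc.2]
  have h1 : Tendsto (fun t : ℝ => Real.exp (-2 * t)) atBot atTop :=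
    Real.tendsto_exp_atTop.comp (tendsto_id.const_mul_atBot_of_neg (by norm_num))
  have h2 : Tendsto (orbitDenom c) atBot atTop :=
    tendsto_atTop_add_const_left _ _ (h1.const_mul_atTop hc2)
  exact (tendsto_const_nhds (x := c)).div_atTop (Real.tendsto_sqrt_atTop.comp h2)

/-! ### The rescaled Reeb component -/

/-- A field which near `x₀` is a rescaling of the model field has a Reeb component. -/
theorem hasReebComponent_of_rescaled_modelField {U : Set R3} {B : R3 → R3}
    (hB : ContDiffOn ℝ ∞ B U) {x₀ : R3} {ε : ℝ} (hε : 0 < ε)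
    (hball : Metric.closedBall x₀ (2 * ε) ⊆ U)
    (hBV : ∀ y ∈ Metric.ball (0 : R3) 3, B (x₀ + ε • y) = ε • modelField y) :
    HasReebComponent U B := by
  obtain ⟨Φ, hΦ⟩ : ∃ Φ : ℝ × ℝ → R3, Φ = fun p => x₀ + ε • planarCylinder p := ⟨_, rfl⟩
  have hE := isCylinderEmbedding_planarCylinder
  have hBΦ : ∀ p ∈ strip, B (Φ p) = ε • modelField (planarCylinder p) := by
    intro p hp
    simp only [hΦ]
    refine hBV _ ?_
    rw [mem_ball_zero_iff]
    linarith [norm_planarCylinder_le (mem_strip.1 hp).2]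
  have hΦball : ∀ p ∈ strip, Φ p ∈ Metric.closedBall x₀ (2 * ε) := by
    intro p hp
    simp only [hΦ]
    rw [mem_closedBall_iff_norm, add_sub_cancel_left, norm_smul, Real.norm_of_nonneg hε.le]
    have := norm_planarCylinder_le (mem_strip.1 hp).2
    nlinarith
  have horb : ∀ θ, ∀ c ∈ Icc (0 : ℝ) 1, IsIntegralCurve B fun t => x₀ + ε • planarOrbit θ c t := by
    intro θ c hc t
    refine (((hasDerivAt_planarOrbit hc θ t).const_smul ε).const_add x₀).congr_deriv ?_
    have := hBΦ (orbitAngle θ c t, orbitHeight c t) (mem_strip.2 (orbitHeight_mem hc t))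
    simp only [hΦ] at this
    exact this.symm
  have hinj : Function.Injective fun y : R3 => x₀ + ε • y := fun y z h =>
    smul_right_injective R3 hε.ne' (add_left_cancel h)
  have hderiv : ∀ p : ℝ × ℝ, p ∈ strip → deriv (fun τ => Φ (τ, p.2)) p.1 =
      ε • cylinderTangentAngle p := by
    intro p hp
    have h := hasDerivAt_planarCylinder_comp (hasDerivAt_id p.1) (hasDerivAt_const p.1 p.2)
      (neg_one_lt_of_mem_strip hp)
    have h' := ((h.const_smul ε).const_add x₀).deriv
    simp only [hΦ]
    simpa using h'
  have hne : ∀ r : ℝ, r = 0 ∨ r = 1 → B (Φ (0, r)) ≠ 0 := by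
    intro r hr
    have hr' : (0, r) ∈ strip := mem_strip.2 (by rcases hr with rfl | rfl <;> simp)
    rw [hBΦ _ hr', modelField_planarCylinder (neg_one_lt_of_mem_strip hr')]
    have hr2 : r * (1 - r ^ 2) = 0 := by rcases hr with rfl | rfl <;> norm_num
    have hr3 : 1 - 2 * r ^ 2 ≠ 0 := by rcases hr with rfl | rfl <;> norm_num
    have hv : angularVec 0 ≠ 0 := fun h => by
      have := congrFun (congrArg WithLp.ofLp h) 1
      simp [angularVec] at this
    have hs : √(1 + r) ≠ 0 := (Real.sqrt_pos.2 (by rcases hr with rfl | rfl <;> norm_num)).ne'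
    simp only [hr2, zero_smul, add_zero, cylinderTangentAngle]
    simp [hε.ne', hr3, hv, hs, Real.pi_ne_zero]
  have hrad : ∀ θ c, c ∈ Icc (0 : ℝ) 1 → Φ (θ + 1, c) = Φ (θ, c) := fun θ c hc => by
    simp only [hΦ, hE.periodic θ c hc]
  have hpi := Real.pi_pos
  refine ⟨Φ, ?_, ?_, ?_, ?_, ?_, ?_, ?_, ?_⟩
  · refine ⟨?_, hrad, fun p hp q hq h => ?_, fun p hp => ?_⟩
    · rw [hΦ]
      exact contDiffOn_const.add (hE.smooth.const_smul ε)
    · simp only [hΦ] at h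
      exact hE.injective p hp q hq (hinj h)
    · have h1 := ((((hasFDerivAt_planarCylinder (neg_one_lt_of_mem_strip hp)).const_smul ε).const_add
        x₀).hasFDerivWithinAt (s := strip)).fderivWithin (uniqueDiffOn_strip p hp)
      have h2 := hE.immersion p hp
      rw [fderivWithin_planarCylinder hp] at h2
      rw [hΦ]
      refine Eq.subst (motive := fun L : ℝ × ℝ →L[ℝ] R3 => Function.Injective L) h1.symm ?_
      exact (smul_right_injective R3 hε.ne').comp h2
  · rintro _ ⟨p, hp, rfl⟩
    exact hball (hΦball p hp)
  · rintro _ ⟨p, hp, rfl⟩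
    refine ⟨_, ?_, horb p.1 p.2 (mem_strip.1 hp), fun t => ?_⟩
    · simp only [planarOrbit_apply_zero, hΦ]
    · refine ⟨(orbitAngle p.1 p.2 t, orbitHeight p.2 t),
        mem_strip.2 (orbitHeight_mem (mem_strip.1 hp) t), ?_⟩
      rw [hΦ]
      rfl
  · refine ⟨fun t => x₀ + ε • planarOrbit 0 0 t, 2 * Real.pi, by positivity,
      horb 0 0 (by simp), fun t => ?_, ?_, ?_⟩
    · have := hrad (0 + t / (2 * Real.pi)) 0 (by simp)
      simp only [hΦ] at this
      simp only [planarOrbit_height_zero]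
      rw [← this]
      congr 4
      field_simp
      ring
    · have := hne 0 (Or.inl rfl)
      simpa only [planarOrbit_apply_zero, hΦ] using this
    · ext x
      simp only [circleAt, mem_range, planarOrbit_height_zero, hΦ]
      constructor
      · rintro ⟨t, rfl⟩
        exact ⟨_, rfl⟩
      · rintro ⟨θ, rfl⟩
        refine ⟨2 * Real.pi * θ, ?_⟩
        congr 4
        field_simp
        ring
  · refine ⟨fun t => x₀ + ε • planarOrbit 0 1 t, 2 * Real.pi, by positivity,
      horb 0 1 (by simp), fun t => ?_, ?_, ?_⟩
    · have := hrad (0 - (t + 2 * Real.pi) / (2 * Real.pi)) 1 (by simp)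
      simp only [hΦ] at this
      simp only [planarOrbit_height_one]
      rw [← this]
      congr 4
      field_simp
      ring
    · have := hne 1 (Or.inr rfl)
      simpa only [planarOrbit_apply_zero, hΦ] using this
    · ext x
      simp only [circleAt, mem_range, planarOrbit_height_one, hΦ]
      constructor
      · rintro ⟨t, rfl⟩
        exact ⟨_, rfl⟩
      · rintro ⟨θ, rfl⟩
        refine ⟨-(2 * Real.pi * θ), ?_⟩
        congr 4
        field_simp
        ring
  · intro θ
    have hp : (θ, (0 : ℝ)) ∈ strip := mem_strip.2 (by simp)
    refine ⟨1 / (2 * Real.pi), by positivity, ?_⟩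
    rw [hBΦ _ hp, hderiv _ hp, modelField_planarCylinder (neg_one_lt_of_mem_strip hp)]
    simp only
    module
  · intro θ
    have hp : (θ, (1 : ℝ)) ∈ strip := mem_strip.2 (by simp)
    refine ⟨1 / (2 * Real.pi), by positivity, ?_⟩
    rw [hBΦ _ hp, hderiv _ hp, modelField_planarCylinder (neg_one_lt_of_mem_strip hp)]
    simp only
    module
  · intro θ r hr γ hγ0 hγ hγm
    have hrI : r ∈ Icc (0 : ℝ) 1 := Ioo_subset_Icc_self hr
    -- Convergence is required for every integral curve in the cylinder. Such curves stay in a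
    -- compact convex ball where the field is Lipschitz, so uniqueness identifies them with the
    -- explicit orbits.
    obtain ⟨K, hK⟩ := (hB.mono hball).exists_lipschitzOnWith (by simp) (convex_closedBall x₀ (2 * ε))
      (isCompact_closedBall x₀ (2 * ε))
    have hγeq : γ = fun t => x₀ + ε • planarOrbit θ r t := by
      refine ODE_solution_unique_univ (v := fun _ => B) (t₀ := 0) (fun _ => hK) (fun t => ⟨hγ t, ?_⟩)
        (fun t => ⟨horb θ r hrI t, ?_⟩) ?_
      · obtain ⟨p, hp, hpt⟩ := hγm t
        exact hpt ▸ hΦball p hp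
      · have := hΦball (orbitAngle θ r t, orbitHeight r t) (mem_strip.2 (orbitHeight_mem hrI t))
        simpa only [hΦ, planarOrbit] using this
      · simp only [hγ0, planarOrbit_apply_zero, hΦ]
    -- The comparison point on the boundary has the same angle, so only the height has to converge.
    have hdist : ∀ a : ℝ, a = 0 ∨ a = 1 → ∀ t,
        Metric.infDist (γ t) (circleAt Φ 0 ∪ circleAt Φ 1) ≤
          ε * |√(1 + orbitHeight r t) - √(1 + a)| := by
      intro a ha t
      have hmem : Φ (orbitAngle θ r t, a) ∈ circleAt Φ 0 ∪ circleAt Φ 1 := by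
        rcases ha with rfl | rfl
        · exact Or.inl ⟨_, rfl⟩
        · exact Or.inr ⟨_, rfl⟩
      refine (Metric.infDist_le_dist_of_mem hmem).trans_eq ?_
      simp only [hγeq, hΦ, planarOrbit]
      rw [dist_eq_norm, add_sub_add_left_eq_sub, ← smul_sub, norm_smul, norm_planarCylinder_sub,
        Real.norm_of_nonneg hε.le]
    have hlim : ∀ (a : ℝ) (l : Filter ℝ), Tendsto (orbitHeight r) l (𝓝 a) →
        Tendsto (fun t => ε * |√(1 + orbitHeight r t) - √(1 + a)|) l (𝓝 0) := by
      intro a l h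
      have := ((((h.const_add 1).sqrt).sub_const (√(1 + a))).abs).const_mul ε
      simpa using this
    exact ⟨squeeze_zero (fun _ => Metric.infDist_nonneg) (hdist 1 (Or.inr rfl))
        (hlim 1 _ (tendsto_orbitHeight_atTop hr)),
      squeeze_zero (fun _ => Metric.infDist_nonneg) (hdist 0 (Or.inl rfl))
        (hlim 0 _ (tendsto_orbitHeight_atBot ⟨hr.1.le, hr.2⟩))⟩

/-! ### The circulation along the boundary of a cylinder -/

theorem inner_eq_sum (v w : R3) : inner ℝ v w = v 0 * w 0 + v 1 * w 1 + v 2 * w 2 := by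
  rw [PiLp.inner_apply, Fin.sum_univ_three]
  simp
  ring

/-- The pointwise form of Stokes: the curl encodes the antisymmetric part of the derivative, that
is, the exterior derivative of the dual 1-form. -/
theorem inner_curlCLM_cross (L : R3 →L[ℝ] R3) (v w : R3) :
    inner ℝ (curlCLM L) (cross v w) = inner ℝ (L v) w - inner ℝ (L w) v := by
  rw [map_eq_sum_basisVec L v, map_eq_sum_basisVec L w]
  simp [inner_eq_sum, curlCLM_apply, cross, cross_apply]
  ring

theorem inner_cross_combination (a b : ℝ) (u v j : R3) :
    inner ℝ (cross (a • u + b • v) j) u = b * inner ℝ j (cross u v) ∧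
      inner ℝ (cross (a • u + b • v) j) v = -(a * inner ℝ j (cross u v)) := by
  constructor <;>
  · simp [inner_eq_sum, cross, cross_apply]
    ring

theorem inner_cross_self (v w : R3) : inner ℝ (cross v w) v = 0 := by
  simp [inner_eq_sum, cross, cross_apply]
  ring

theorem inner_gradient (P : R3 → ℝ) (x v : R3) : inner ℝ (gradient P x) v = fderiv ℝ P x v := by
  rw [gradient, InnerProductSpace.toDual_symm_apply]

theorem fderiv_inner_fderiv_apply {G Y : ℝ × ℝ → R3} {p : ℝ × ℝ} (hG : DifferentiableAt ℝ G p)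
    (hY : DifferentiableAt ℝ (fderiv ℝ Y) p) (e : ℝ × ℝ) :
    DifferentiableAt ℝ (fun p => inner ℝ (G p) (fderiv ℝ Y p e)) p ∧
      ∀ v, fderiv ℝ (fun p => inner ℝ (G p) (fderiv ℝ Y p e)) p v =
        inner ℝ (G p) (fderiv ℝ (fderiv ℝ Y) p v e) + inner ℝ (fderiv ℝ G p v) (fderiv ℝ Y p e) := by
  have h1 : DifferentiableAt ℝ (fun p => fderiv ℝ Y p e) p := hY.clm_apply (by fun_prop)
  refine ⟨hG.inner ℝ h1, fun v => ?_⟩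
  rw [fderiv_inner_apply ℝ hG h1, fderiv_clm_apply hY (by fun_prop)]
  simp

/-- If the flux of the curl through a cylinder vanishes pointwise, then the circulations along
both boundary circles agree. -/
theorem circulation_eq_of_curl_flux_eq_zero {Y : ℝ × ℝ → R3} {S : Set (ℝ × ℝ)} (hS : IsOpen S)
    (hY : ContDiffOn ℝ ∞ Y S) (hsub : strip ⊆ S) {F : R3 → R3}
    (hF : ∀ p ∈ S, ContDiffAt ℝ ∞ F (Y p))
    (hcurl : ∀ p : ℝ × ℝ, p.2 ∈ Ioo (0 : ℝ) 1 →
      inner ℝ (curl F (Y p)) (cross (fderiv ℝ Y p (1, 0)) (fderiv ℝ Y p (0, 1))) = 0)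
    (hper : ∀ r ∈ Icc (0 : ℝ) 1, inner ℝ (F (Y (1, r))) (fderiv ℝ Y (1, r) (0, 1)) =
      inner ℝ (F (Y (0, r))) (fderiv ℝ Y (0, r) (0, 1))) :
    ∫ θ in (0 : ℝ)..1, inner ℝ (F (Y (θ, 1))) (fderiv ℝ Y (θ, 1) (1, 0)) =
      ∫ θ in (0 : ℝ)..1, inner ℝ (F (Y (θ, 0))) (fderiv ℝ Y (θ, 0) (1, 0)) := by
  have hYat : ∀ p ∈ S, ContDiffAt ℝ ∞ Y p := fun p hp => hY.contDiffAt (hS.mem_nhds hp)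
  -- `a e` is the `e`-component of the pull-back by `Y` of the 1-form dual to `F`.
  obtain ⟨a, ha⟩ : ∃ a : ℝ × ℝ → ℝ × ℝ → ℝ, a = fun e p => inner ℝ (F (Y p)) (fderiv ℝ Y p e) :=
    ⟨_, rfl⟩
  have hGs : ContDiffOn ℝ ∞ (fun p => F (Y p)) S := fun p hp =>
    ((hF p hp).comp p (hYat p hp)).contDiffWithinAt
  have hY' : ContDiffOn ℝ ∞ (fderiv ℝ Y) S := hY.fderiv_of_isOpen hS (by simp)
  have has : ∀ e, ContDiffOn ℝ ∞ (a e) S := fun e => by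
    rw [ha]
    exact hGs.inner ℝ (hY'.clm_apply contDiffOn_const)
  have hd : ∀ e, ∀ p ∈ S, DifferentiableAt ℝ (a e) p ∧ ∀ v, fderiv ℝ (a e) p v =
      inner ℝ (F (Y p)) (fderiv ℝ (fderiv ℝ Y) p v e) +
        inner ℝ (fderiv ℝ F (Y p) (fderiv ℝ Y p v)) (fderiv ℝ Y p e) := by
    intro e p hp
    have hFd := (hF p hp).differentiableAt (by simp)
    have hYd := (hYat p hp).differentiableAt (by simp)
    have h1 := fderiv_inner_fderiv_apply (G := fun p => F (Y p))
      ((hGs.contDiffAt (hS.mem_nhds hp)).differentiableAt (by simp))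
      ((hY'.contDiffAt (hS.mem_nhds hp)).differentiableAt (by simp)) e
    have h2 : fderiv ℝ (fun p => F (Y p)) p = (fderiv ℝ F (Y p)).comp (fderiv ℝ Y p) :=
      fderiv_comp p hFd hYd
    rw [h2] at h1
    rw [ha]
    exact h1
  have hsq : uIcc (0 : ℝ) 1 ×ˢ uIcc (0 : ℝ) 1 ⊆ S := fun p hp =>
    hsub (mem_strip.2 (by simpa using hp.2))
  -- The pulled-back form is closed: second derivatives of `Y` cancel by symmetry, and what remains
  -- is the flux density of the curl.
  have hzero : ∀ p : ℝ × ℝ, p.2 ∈ Ioo (0 : ℝ) 1 →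
      fderiv ℝ (a (0, 1)) p (1, 0) + fderiv ℝ (fun p => -a (1, 0) p) p (0, 1) = 0 := by
    intro p hp
    have hpS : p ∈ S := hsub (mem_strip.2 (Ioo_subset_Icc_self hp))
    have hsymm : IsSymmSndFDerivAt ℝ Y p := (contDiffAt_infty.1 (hYat p hpS) 2).isSymmSndFDerivAt (by simp)
    have h := hcurl p hp
    rw [curl_eq, inner_curlCLM_cross] at h
    rw [fderiv_fun_neg, neg_apply, (hd _ p hpS).2, (hd _ p hpS).2, hsymm (0, 1) (1, 0)]
    linarith
  have hdiv := integral2_divergence_prod_of_hasFDerivAt (a (0, 1)) (fun p => -a (1, 0) p)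
    (fderiv ℝ (a (0, 1))) (fderiv ℝ fun p => -a (1, 0) p) 0 0 1 1
    ((has _).continuousOn.mono hsq) ((has _).neg.continuousOn.mono hsq)
    (fun p hp => (hd _ p (hsq ⟨Ioo_subset_Icc_self hp.1, Ioo_subset_Icc_self hp.2⟩)).1.hasFDerivAt)
    (fun p hp =>
      (hd _ p (hsq ⟨Ioo_subset_Icc_self hp.1, Ioo_subset_Icc_self hp.2⟩)).1.neg.hasFDerivAt)
    (by
      refine ContinuousOn.integrableOn_compact (isCompact_uIcc.prod isCompact_uIcc) ?_
      refine (ContinuousOn.add ?_ ?_).mono hsq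
      · exact ((has (0, 1)).continuousOn_fderiv_of_isOpen hS (by simp)).clm_apply continuousOn_const
      · exact ((has (1, 0)).neg.continuousOn_fderiv_of_isOpen hS (by simp)).clm_apply
          continuousOn_const)
  have hleft : ∫ x in (0 : ℝ)..1, ∫ y in (0 : ℝ)..1, fderiv ℝ (a (0, 1)) (x, y) (1, 0) +
      fderiv ℝ (fun p => -a (1, 0) p) (x, y) (0, 1) = 0 := by
    have : ∀ x : ℝ, ∫ y in (0 : ℝ)..1, fderiv ℝ (a (0, 1)) (x, y) (1, 0) +
        fderiv ℝ (fun p => -a (1, 0) p) (x, y) (0, 1) = 0 := fun x => by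
      refine intervalIntegral.integral_zero_ae ?_
      -- The flux hypothesis covers only interior heights; the endpoint 1 is discarded as a null
      -- set.
      filter_upwards [(countable_singleton (1 : ℝ)).ae_notMem volume] with y hy hy'
      rw [uIoc_of_le zero_le_one] at hy'
      exact hzero (x, y) ⟨hy'.1, lt_of_le_of_ne hy'.2 hy⟩
    simp only [this, intervalIntegral.integral_zero]
  have hsides : ∫ y in (0 : ℝ)..1, a (0, 1) (1, y) = ∫ y in (0 : ℝ)..1, a (0, 1) (0, y) := by
    refine intervalIntegral.integral_congr fun y hy => ?_
    rw [uIcc_of_le zero_le_one] at hy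
    rw [ha]
    exact hper y hy
  rw [hleft, hsides, intervalIntegral.integral_neg, intervalIntegral.integral_neg] at hdiv
  have : ∫ θ in (0 : ℝ)..1, a (1, 0) (θ, 1) = ∫ θ in (0 : ℝ)..1, a (1, 0) (θ, 0) := by linarith
  rw [ha] at this
  exact this

/-! ### First integrals on the cylinder -/

/-- A continuous function on the disc which is constant on orbits of the model field is constant
on the cylinder. -/
theorem eq_const_of_orbit_invariant {φ : R3 → ℝ} (hφ : ContinuousOn φ (Metric.closedBall 0 2))
    (hinv : ∀ θ, ∀ c ∈ Icc (0 : ℝ) 1, ∀ t, φ (planarOrbit θ c t) = φ (planarOrbit θ c 0))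
    (θ : ℝ) {c : ℝ} (hc : c ∈ Ico (0 : ℝ) 1) :
    φ (planarCylinder (θ, c)) = φ (planarCylinder (0, 0)) := by
  have hpi := Real.pi_pos
  have hzero : ∀ θ, φ (planarCylinder (θ, 0)) = φ (planarCylinder (0, 0)) := by
    intro θ
    have := hinv 0 0 (by simp) (2 * Real.pi * θ)
    rw [planarOrbit_height_zero, planarOrbit_apply_zero] at this
    rw [← this]
    congr 3
    field_simp
    ring
  have hcI : c ∈ Icc (0 : ℝ) 1 := Ico_subset_Icc_self hc
  have hmem : ∀ θ, ∀ r ∈ Icc (0 : ℝ) 1, planarCylinder (θ, r) ∈ Metric.closedBall (0 : R3) 2 :=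
    fun θ r hr => by
      rw [mem_closedBall_zero_iff]
      exact norm_planarCylinder_le hr.2
  -- The orbit spirals backwards onto the circle `r = 0` with no limiting angle. Uniform continuity
  -- compares it with the point of that circle at the same angle, where `φ` is already known.
  have huc := (isCompact_closedBall (0 : R3) 2).uniformContinuousOn_of_continuous hφ
  rw [Metric.uniformContinuousOn_iff] at huc
  refine eq_of_forall_dist_le fun η hη => ?_
  obtain ⟨d, hd, hφd⟩ := huc η hη
  have hlim : Tendsto (fun t => |√(1 + orbitHeight c t) - √(1 + 0)|) atBot (𝓝 0) := by
    have h := (tendsto_orbitHeight_atBot hc)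
    simpa using (((h.const_add 1).sqrt).sub_const (√(1 + 0))).abs
  obtain ⟨t, ht⟩ := (hlim.eventually_lt_const hd).exists
  have h1 := hφd _ (hmem (orbitAngle θ c t) _ (orbitHeight_mem hcI t)) _
    (hmem (orbitAngle θ c t) 0 (by simp)) (by rwa [dist_eq_norm, norm_planarCylinder_sub])
  rw [hzero] at h1
  have h2 := hinv θ c hcI t
  rw [planarOrbit_apply_zero] at h2
  rw [← h2]
  exact h1.le

/-! ### The obstruction -/

/-- A smooth immersion of a neighbourhood of the cylinder cannot transport the model field to a
magnetohydrostatic equilibrium. -/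
theorem not_equilibrium_of_conjugate {Ψ F : R3 → R3} {P : R3 → ℝ}
    (hΨ : ContDiffOn ℝ ∞ Ψ (Metric.ball 0 3))
    (hinj : ∀ y ∈ Metric.ball (0 : R3) 3, Function.Injective (fderiv ℝ Ψ y))
    (hF : ∀ y ∈ Metric.ball (0 : R3) 3, ContDiffAt ℝ ∞ F (Ψ y))
    (hP : ∀ y ∈ Metric.ball (0 : R3) 3, ContDiffAt ℝ ∞ P (Ψ y))
    (hconj : ∀ y ∈ Metric.ball (0 : R3) 3, F (Ψ y) = fderiv ℝ Ψ y (modelField y))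
    (heq : ∀ y ∈ Metric.ball (0 : R3) 3,
      cross (F (Ψ y)) (curl F (Ψ y)) + gradient P (Ψ y) = 0) : False := by
  have hpi := Real.pi_pos
  have hball : ∀ p ∈ strip, planarCylinder p ∈ Metric.ball (0 : R3) 3 := fun p hp => by
    rw [mem_ball_zero_iff]
    linarith [norm_planarCylinder_le (mem_strip.1 hp).2]
  obtain ⟨S, hSdef⟩ : ∃ S : Set (ℝ × ℝ), S = {p | -1 < p.2} ∩ planarCylinder ⁻¹' Metric.ball 0 3 :=
    ⟨_, rfl⟩
  have hS : IsOpen S := by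
    rw [hSdef]
    exact contDiffOn_planarCylinder.continuousOn.isOpen_inter_preimage
      (isOpen_lt continuous_const continuous_snd) Metric.isOpen_ball
  have hstrip : strip ⊆ S := fun p hp => by
    rw [hSdef]
    exact ⟨neg_one_lt_of_mem_strip hp, hball p hp⟩
  have hSball : ∀ p ∈ S, planarCylinder p ∈ Metric.ball (0 : R3) 3 := fun p hp => by
    rw [hSdef] at hp
    exact hp.2
  have hSlt : ∀ p ∈ S, -1 < p.2 := fun p hp => by
    rw [hSdef] at hp
    exact hp.1
  obtain ⟨Y, hYdef⟩ : ∃ Y : ℝ × ℝ → R3, Y = Ψ ∘ planarCylinder := ⟨_, rfl⟩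
  have hY : ContDiffOn ℝ ∞ Y S := by
    rw [hYdef]
    exact hΨ.comp (contDiffOn_planarCylinder.mono hSlt) hSball
  have hΨd : ∀ y ∈ Metric.ball (0 : R3) 3, DifferentiableAt ℝ Ψ y := fun y hy =>
    (hΨ.contDiffAt (Metric.isOpen_ball.mem_nhds hy)).differentiableAt (by simp)
  have hPd : ∀ y ∈ Metric.ball (0 : R3) 3, DifferentiableAt ℝ P (Ψ y) := fun y hy =>
    (hP y hy).differentiableAt (by simp)
  have hY' : ∀ p ∈ S, ∀ v : ℝ × ℝ, fderiv ℝ Y p v = fderiv ℝ Ψ (planarCylinder p)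
      (v.1 • cylinderTangentAngle p + v.2 • cylinderTangentHeight p) := by
    intro p hp v
    have h := ((hΨd _ (hSball p hp)).hasFDerivAt.comp p
      (hasFDerivAt_planarCylinder (hSlt p hp))).fderiv
    rw [hYdef, h]
    simp
  have hYθ : ∀ p ∈ S, fderiv ℝ Y p (1, 0) =
      fderiv ℝ Ψ (planarCylinder p) (cylinderTangentAngle p) := fun p hp => by
    rw [hY' p hp]; simp
  have hYr : ∀ p ∈ S, fderiv ℝ Y p (0, 1) =
      fderiv ℝ Ψ (planarCylinder p) (cylinderTangentHeight p) := fun p hp => by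
    rw [hY' p hp]; simp
  have hFY : ∀ p ∈ S, F (Y p) = ((1 - 2 * p.2 ^ 2) / (2 * Real.pi)) • fderiv ℝ Y p (1, 0) +
      (p.2 * (1 - p.2 ^ 2)) • fderiv ℝ Y p (0, 1) := by
    intro p hp
    rw [hYθ p hp, hYr p hp, ← map_smul, ← map_smul, ← map_add,
      ← modelField_planarCylinder (hSlt p hp), ← hconj _ (hSball p hp), hYdef]
    rfl
  have hPgrad : ∀ y ∈ Metric.ball (0 : R3) 3, ∀ v, fderiv ℝ P (Ψ y) v =
      -inner ℝ (cross (F (Ψ y)) (curl F (Ψ y))) v := by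
    intro y hy v
    rw [← inner_gradient, ← inner_neg_left, eq_neg_of_add_eq_zero_right (heq y hy)]
  have hconst : ∀ θ, ∀ c ∈ Ico (0 : ℝ) 1,
      P (Y (θ, c)) = P (Y (0, 0)) := by
    intro θ c hc
    rw [hYdef]
    refine eq_const_of_orbit_invariant (φ := P ∘ Ψ) (fun y hy => ?_) (fun θ c hc t => ?_) θ hc
    · have hy' : y ∈ Metric.ball (0 : R3) 3 := Metric.closedBall_subset_ball (by norm_num) hy
      exact ((hPd y hy').continuousAt.comp (hΨd y hy').continuousAt).continuousWithinAt
    · refine is_const_of_deriv_eq_zero (f := fun t => P (Ψ (planarOrbit θ c t))) ?_ ?_ t 0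
      all_goals
        have hder : ∀ t, HasDerivAt (fun t => P (Ψ (planarOrbit θ c t))) 0 t := by
          intro t
          have hyt : planarOrbit θ c t ∈ Metric.ball (0 : R3) 3 :=
            hball _ (mem_strip.2 (orbitHeight_mem hc t))
          have h1 := (hΨd _ hyt).hasFDerivAt.comp_hasDerivAt t (hasDerivAt_planarOrbit hc θ t)
          have h2 := HasFDerivAt.comp_hasDerivAt t (hPd _ hyt).hasFDerivAt h1
          refine h2.congr_deriv ?_
          -- The derivative of the pressure along an orbit is `-(F × curl F) · F = 0`.
          rw [← hconj _ hyt, hPgrad _ hyt, inner_cross_self, neg_zero]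
      · exact fun t => (hder t).differentiableAt
      · exact fun t => (hder t).deriv
  have hflux : ∀ p : ℝ × ℝ, p.2 ∈ Ioo (0 : ℝ) 1 →
      inner ℝ (curl F (Y p)) (cross (fderiv ℝ Y p (1, 0)) (fderiv ℝ Y p (0, 1))) = 0 := by
    intro p hp
    have hpS : p ∈ S := hstrip (mem_strip.2 (Ioo_subset_Icc_self hp))
    have hloc : (fun p => P (Y p)) =ᶠ[𝓝 p] fun _ => P (Y (0, 0)) := by
      filter_upwards [(isOpen_Ioo.preimage continuous_snd).mem_nhds hp] with q hq
      exact hconst q.1 q.2 (Ioo_subset_Ico_self hq)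
    have hPY : ∀ v, fderiv ℝ P (Y p) (fderiv ℝ Y p v) = 0 := by
      intro v
      have hYd : DifferentiableAt ℝ Y p :=
        (hY.contDiffAt (hS.mem_nhds hpS)).differentiableAt (by simp)
      have hPY : DifferentiableAt ℝ P (Y p) := by
        rw [hYdef]
        exact hPd _ (hSball p hpS)
      have h := hloc.fderiv_eq (𝕜 := ℝ)
      rw [fderiv_const_apply] at h
      have h2 : fderiv ℝ (fun p => P (Y p)) p = (fderiv ℝ P (Y p)).comp (fderiv ℝ Y p) :=
        fderiv_comp p hPY hYd
      rw [h2] at h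
      exact congrArg (fun L : ℝ × ℝ →L[ℝ] ℝ => L v) h
    have hgr : ∀ v, inner ℝ (cross (F (Y p)) (curl F (Y p))) (fderiv ℝ Y p v) = 0 := by
      intro v
      have h := hPgrad _ (hSball p hpS) (fderiv ℝ Y p v)
      have h' := hPY v
      simp only [hYdef, Function.comp_apply] at h h' ⊢
      linarith
    have h1 := hgr (1, 0)
    have h2 := hgr (0, 1)
    rw [hFY p hpS] at h1 h2
    -- Pairing with `∂θ` removes the angular part of `F` and leaves the flux density times the
    -- radial speed, which is nonzero for `0 < r < 1`.
    rw [(inner_cross_combination _ _ _ _ _).1] at h1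
    have hb : p.2 * (1 - p.2 ^ 2) ≠ 0 := by
      have : 0 < 1 - p.2 ^ 2 := by nlinarith [hp.1, hp.2]
      exact (mul_pos hp.1 this).ne'
    exact (mul_eq_zero.1 h1).resolve_left hb
  have hcirc := circulation_eq_of_curl_flux_eq_zero hS hY hstrip
    (F := F) (fun p hp => by rw [hYdef]; exact hF _ (hSball p hp)) hflux (by
      intro r hr
      have h0 : ((0 : ℝ), r) ∈ S := hstrip (mem_strip.2 hr)
      have h1 : ((1 : ℝ), r) ∈ S := hstrip (mem_strip.2 hr)
      have h2 := isCylinderEmbedding_planarCylinder.periodic 0 r hr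
      rw [zero_add] at h2
      have h3 : radialVec 1 = radialVec 0 := by
        have := radialVec_add_one 0
        rwa [zero_add] at this
      rw [hYr _ h0, hYr _ h1, hYdef]
      simp only [Function.comp_apply, h2, cylinderTangentHeight, h3])
  have hsq : ∀ r : ℝ, r = 0 ∨ r = 1 → 0 < ∫ θ in (0 : ℝ)..1, ‖fderiv ℝ Y (θ, r) (1, 0)‖ ^ 2 := by
    intro r hr
    have hrs : ∀ θ, (θ, r) ∈ strip := fun θ => mem_strip.2 (by rcases hr with rfl | rfl <;> simp)
    have hcont : Continuous fun θ : ℝ => ‖fderiv ℝ Y (θ, r) (1, 0)‖ ^ 2 := by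
      have h1 : ContinuousOn (fderiv ℝ Y) S := hY.continuousOn_fderiv_of_isOpen hS (by simp)
      have h2 : Continuous fun θ : ℝ => fderiv ℝ Y (θ, r) :=
        h1.comp_continuous (by fun_prop) fun θ => hstrip (hrs θ)
      exact ((h2.clm_apply continuous_const).norm).pow 2
    refine intervalIntegral.intervalIntegral_pos_of_pos (hcont.intervalIntegrable _ _)
      (fun θ => ?_) zero_lt_one
    have hne : fderiv ℝ Y (θ, r) (1, 0) ≠ 0 := by
      rw [hYθ _ (hstrip (hrs θ)), ne_eq, map_eq_zero_iff _ (hinj _ (hball _ (hrs θ)))]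
      have h1 : 0 < √(1 + r) := Real.sqrt_pos.2 (by rcases hr with rfl | rfl <;> norm_num)
      have h2 : angularVec θ ≠ 0 := fun h => by
        have e0 := congrFun (congrArg WithLp.ofLp h) 0
        have e1 := congrFun (congrArg WithLp.ofLp h) 1
        have := Real.cos_sq_add_sin_sq (2 * Real.pi * θ)
        simp [angularVec] at e0 e1
        rw [e0, e1] at this
        norm_num at this
      exact smul_ne_zero (by positivity) h2
    positivity
  -- On the boundary circles the radial term drops out, so the circulation integrand has the sign of
  -- `1 - 2r²`, namely `+` at `r = 0` and `-` at `r = 1`.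
  have hval : ∀ r θ : ℝ, r = 0 ∨ r = 1 →
      inner ℝ (F (Y (θ, r))) (fderiv ℝ Y (θ, r) (1, 0)) =
        ((1 - 2 * r ^ 2) / (2 * Real.pi)) * ‖fderiv ℝ Y (θ, r) (1, 0)‖ ^ 2 := by
    intro r θ hr
    have hrs : (θ, r) ∈ strip := mem_strip.2 (by rcases hr with rfl | rfl <;> simp)
    have hr2 : r * (1 - r ^ 2) = 0 := by rcases hr with rfl | rfl <;> norm_num
    rw [hFY _ (hstrip hrs)]
    simp only [hr2, zero_smul, add_zero]
    rw [real_inner_smul_left, real_inner_self_eq_norm_sq]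
  simp only [hval 0 _ (Or.inl rfl), hval 1 _ (Or.inr rfl), intervalIntegral.integral_const_mul]
    at hcirc
  have hpos : 0 < 1 / (2 * Real.pi) := by positivity
  have h0 := mul_pos hpos (hsq 0 (Or.inl rfl))
  have h1 := mul_pos hpos (hsq 1 (Or.inr rfl))
  rw [show (1 - 2 * (0 : ℝ) ^ 2) / (2 * Real.pi) = 1 / (2 * Real.pi) by ring,
    show (1 - 2 * (1 : ℝ) ^ 2) / (2 * Real.pi) = -(1 / (2 * Real.pi)) by ring] at hcirc
  linarith

/-- A field which near `x₀` is a rescaling of the model field is not topologically equivalent to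
a magnetohydrostatic equilibrium. -/
theorem not_isTopEquivToMHS_of_rescaled_modelField {U : Set R3} (hU : IsOpen U) {B : R3 → R3}
    {x₀ : R3} {ε : ℝ} (hε : 0 < ε) (hball : ∀ y ∈ Metric.ball (0 : R3) 3, x₀ + ε • y ∈ U)
    (hBV : ∀ y ∈ Metric.ball (0 : R3) 3, B (x₀ + ε • y) = ε • modelField y) :
    ¬ IsTopEquivToMHS U B := by
  rintro ⟨X, hX, P, hP, heq⟩
  have hXd : ∀ x ∈ U, DifferentiableAt ℝ X.toFun x := fun x hx =>
    (X.smooth.contDiffAt (hU.mem_nhds hx)).differentiableAt (by simp)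
  have hΨ' : ∀ y ∈ Metric.ball (0 : R3) 3, fderiv ℝ (fun y => X.toFun (x₀ + ε • y)) y =
      ε • fderiv ℝ X.toFun (x₀ + ε • y) := fun y hy =>
    (hasFDerivAt_comp_affine x₀ ε (hXd _ (hball y hy))).fderiv
  have hXU : ∀ y ∈ Metric.ball (0 : R3) 3, X.toFun (x₀ + ε • y) ∈ U := fun y hy =>
    X.mapsTo (hball y hy)
  refine not_equilibrium_of_conjugate (Ψ := fun y => X.toFun (x₀ + ε • y)) (F := X.pushforward B)
    (P := P) ?_ (fun y hy => ?_) (fun y hy => hX.smooth.contDiffAt (hU.mem_nhds (hXU y hy)))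
    (fun y hy => hP.contDiffAt (hU.mem_nhds (hXU y hy))) (fun y hy => ?_)
    (fun y hy => heq _ (hXU y hy))
  · exact X.smooth.comp (contDiff_const.add (contDiff_id.const_smul ε)).contDiffOn hball
  · rw [hΨ' y hy]
    -- Volume preservation enters only here, to make the derivative invertible.
    have hdet : (fderiv ℝ X.toFun (x₀ + ε • y)).det ≠ 0 := fun h => by
      have := X.volume_preserving _ (hball y hy)
      rw [h] at this
      norm_num at this
    have h1 : Function.Injective (fderiv ℝ X.toFun (x₀ + ε • y)) :=
      ((fderiv ℝ X.toFun (x₀ + ε • y)).toContinuousLinearEquivOfDetNeZero hdet).injective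
    exact (smul_right_injective R3 hε.ne').comp h1
  -- The chain-rule factor `ε` matches the amplitude `ε` of the rescaled model, so no change of time
  -- is needed.
  · rw [hΨ' y hy, VolumePreservingDiffeo.pushforward, X.left_inv (hball y hy), hBV y hy]
    simp

end ReebMHS

/-! ### The perturbed field -/

theorem corollaryA2 (U : Set ReebMHS.R3) (hU : IsOpen U)
    (B₀ : ReebMHS.R3 → ReebMHS.R3) (hB₀ : ReebMHS.IsSmoothDivFree U B₀)
    (x₀ : ReebMHS.R3) (hx₀ : x₀ ∈ U) (hne : B₀ x₀ ≠ 0)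
    (s : ℝ) (hs₀ : 0 ≤ s) (hs : s < 3 / 2) (δ : ℝ) (hδ : 0 < δ) :
    ∃ B : ReebMHS.R3 → ReebMHS.R3,
      ReebMHS.IsSmoothDivFree U B ∧
      (∃ x ∈ U, B x ≠ B₀ x) ∧
      ReebMHS.HasReebComponent U B ∧
      (∀ x ∈ U, x ∉ Metric.ball x₀ δ → B x = B₀ x) ∧
      ReebMHS.sobolevNormOn s U (fun x => B₀ x - B x) < ENNReal.ofReal δ ∧
      ¬ ReebMHS.IsTopEquivToMHS U B := by
  obtain ⟨W, hW, hW0, hdW, ε₀, hε₀, hWε⟩ := ReebMHS.exists_divFree_interpolation hU hB₀ hx₀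
    ReebMHS.contDiff_modelField ReebMHS.div_modelField
  obtain ⟨r, hr, hrU⟩ := Metric.isOpen_iff.1 hU x₀ hx₀
  -- `ε₀` validates the interpolation, `δ / 4` keeps the correction (zero for `4 ≤ ‖y‖`) inside the
  -- `δ`-ball, and `r / 3` keeps the rescaled ball of radius 3 inside `U`.
  have hsmall : ∀ᶠ ε in 𝓝[>] (0 : ℝ), ε < min ε₀ (min (δ / 4) (r / 3)) :=
    nhdsWithin_le_nhds (Iio_mem_nhds (by positivity))
  obtain ⟨ε, hnorm, hεlt, hε⟩ := ((ReebMHS.exists_sobolevNormOn_rescale_lt hW hW0 U x₀ hs₀ hs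
    hδ).and (hsmall.and self_mem_nhdsWithin)).exists
  replace hε : 0 < ε := hε
  have hεε₀ : ε < ε₀ := hεlt.trans_le (min_le_left _ _)
  have hεδ : ε < δ / 4 := hεlt.trans_le ((min_le_right _ _).trans (min_le_left _ _))
  have hεr : ε < r / 3 := hεlt.trans_le ((min_le_right _ _).trans (min_le_right _ _))
  obtain ⟨w, hw⟩ : ∃ w : ReebMHS.R3 → ReebMHS.R3, w = fun x => W ε (-(ε⁻¹ • x₀) + ε⁻¹ • x) :=
    ⟨_, rfl⟩
  have hw' : ∀ x, w x = W ε (ε⁻¹ • (x - x₀)) := fun x => by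
    rw [hw, smul_sub, sub_eq_neg_add]
  have hWs := ReebMHS.contDiff_of_uncurry hW ε
  have hws : ContDiff ℝ ∞ w := by
    rw [hw]
    exact hWs.comp (contDiff_const.add (contDiff_id.const_smul ε⁻¹))
  have hBV : ∀ y ∈ Metric.ball (0 : ReebMHS.R3) 3,
      B₀ (x₀ + ε • y) - w (x₀ + ε • y) = ε • ReebMHS.modelField y := by
    intro y hy
    rw [hw', add_sub_cancel_left, inv_smul_smul₀ hε.ne', hWε ε hε hεε₀ y hy, sub_sub_cancel]
  have hball : ∀ y ∈ Metric.ball (0 : ReebMHS.R3) 3, x₀ + ε • y ∈ U := by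
    intro y hy
    refine hrU ?_
    rw [mem_ball_zero_iff] at hy
    rw [mem_ball_iff_norm, add_sub_cancel_left, norm_smul, Real.norm_of_nonneg hε.le]
    have := norm_nonneg y
    nlinarith
  have hBs : ContDiffOn ℝ ∞ (fun x => B₀ x - w x) U := hB₀.smooth.sub hws.contDiffOn
  refine ⟨fun x => B₀ x - w x, ⟨hBs, fun x hx => ?_⟩, ⟨x₀, hx₀, ?_⟩, ?_, fun x _ hx => ?_, ?_, ?_⟩
  · rw [ReebMHS.div_sub ((hB₀.smooth.contDiffAt (hU.mem_nhds hx)).differentiableAt (by simp))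
      (hws.differentiable (by simp) x), hB₀.div_eq_zero x hx, hw,
      ReebMHS.div_comp_affine _ _ (hWs.differentiable (by simp) _), hdW]
    simp
  -- The model field vanishes at the origin, so the new field vanishes at `x₀`, where `B₀` does not.
  · have h := hBV 0 (by simp)
    rw [smul_zero, add_zero, ReebMHS.modelField_zero, smul_zero] at h
    simp only [h]
    exact hne.symm
  · refine ReebMHS.hasReebComponent_of_rescaled_modelField hBs hε (fun x hx => hrU ?_) hBV
    rw [mem_closedBall_iff_norm] at hx
    rw [mem_ball_iff_norm]
    linarith
  · have h : w x = 0 := by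
      rw [hw']
      refine hW0 ε _ ?_
      rw [norm_smul, norm_inv, Real.norm_of_nonneg hε.le, le_inv_mul_iff₀ hε]
      rw [mem_ball_iff_norm, not_lt] at hx
      linarith
    simp only [h, sub_zero]
  · simp only [sub_sub_cancel, hw']
    exact hnorm
  · exact ReebMHS.not_isTopEquivToMHS_of_rescaled_modelField hU hε hball hBV
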